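/- Let $J$ be a finite set, $A_i \in M_2(\mathbb{R})$ and $v_i \in \mathbb{R}^2$ for $i \in J$, and suppose that the affine maps $f_i(x) = A_i x + v_i$ on $\mathbb{R}^2$ are strictly contractive in the Euclidean norm ($\max_{i\in J}\|A_i\| < 1$) and do not have a common fixed point. Put $I = \{i \in J : A_i \text{ is invertible}\}$ and suppose that $I \neq \emptyset$. Let $X'$ and $X$ be the non-empty compact sets with $X' = \bigcup_{i\in J} f_i(X')$ and $X = \bigcup_{i \in I} f_i(X)$. For $A \in M_2(\mathbb{R})$ with singular values $\alpha_1(A) \ge \alpha_2(A)$ let $\varphi^s(A) = \alpha_1(A)^s$ if $0 \le s \le 1$, $\varphi^s(A) = \alpha_1(A)\alpha_2(A)^{s-1}$ if $1 < s \le 2$, and $\varphi^s(A) = |\det A|^{s/2}$ if $s > 2$, where $0^0 = 1$. For $\Gamma \in \{J^{\mathbb{N}}, I^{\mathbb{N}}\}$ let $\Gamma_n$ be the set of the initial words of length $n$ of elements of $\Gamma$, and define $$P(\Gamma,\mathsf{A},s) = \lim_{n\to\infty} \frac1n \log \sum_{i_1\cdots i_n \in \Gamma_n} \varphi^s(A_{i_1}\cdots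 A_{i_n}) = \inf_{n \ge 1} \frac1n \log \sum_{i_1\cdots i_n \in \Gamma_n} \varphi^s(A_{i_1}\cdots A_{i_n}) \in [-\infty,\infty),$$ $$\dim_{\mathrm{aff}}(\Gamma,\mathsf{A}) = \inf\{s \ge 0 : P(\Gamma,\mathsf{A},s) \le 0\}.$$ Suppose that the following hold. 1. The tuple $\mathsf{A} = (A_i)_{i\in J}$ is irreducible (there is no line $V \in \mathbb{RP}^1$ through the origin with $A_i V \subset V$ for all $i \in J$) or dominated (every $A_i$ is non-zero, and there is a proper subset $\mathcal{C}$ of $\mathbb{RP}^1$, a finite non-empty union of closed projective intervals that are neither a point nor all of $\mathbb{RP}^1$, such that for all $i \in J$ each line in $\mathcal{C}$ is mapped by $A_i$ onto a line in the interior of $\mathcal{C}$). 2. At least one of the matrices $A_i$ has rank one. 3. $\dim_{\mathrm{aff}}(I^{\mathbb{N}},\mathsf{A}) < 1$. 4. $\dim_{\mathrm{H}}(X') = \min\{2, \dim_{\mathrm{aff}}(J^{\mathbb{N}},\mathsf{A})\}$. Then $\dim_{\mathrm{H}}(X') > \overline{\dim}_{\mathrm{M}}(X)$, where $\dim_{\mathrm{H}}$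 is the Hausdorff dimension and $\overline{\dim}_{\mathrm{M}}$ the upper Minkowski dimension. -/

import Mathlib

open scoped ENNReal NNReal

noncomputable section

namespace PlanarAffine

/-- The Euclidean plane. -/
abbrev Plane : Type := EuclideanSpace ℝ (Fin 2)

/-- Real `2 × 2` matrices. -/
abbrev Mat : Type := Matrix (Fin 2) (Fin 2) ℝ

/-- The linear self-map of the Euclidean plane given by a matrix. -/
abbrev lin (A : Mat) : Plane →ₗ[ℝ] Plane := Matrix.toEuclideanLin A

/-! ### Affine iterated function systems and self-affine sets -/

/-- The affine map `x ↦ A x + v`. -/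
def affMap (A : Mat) (v : Plane) (x : Plane) : Plane := lin A x + v

/-- The tuple of maps `x ↦ A i x + v i` is an affine iterated function system: each map is
contractive (the Euclidean operator norm of `A i` is less than one), and the maps do not have a
common fixed point. -/
structure IsAffineIFS {J : Type*} (A : J → Mat) (v : J → Plane) : Prop where
  contractive : ∀ i, ‖Matrix.toEuclideanCLM (n := Fin 2) (𝕜 := ℝ) (A i)‖ < 1
  no_common_fixed_point : ¬ ∃ x : Plane, ∀ i, affMap (A i) (v i) x = x

/-- `X` is the self-affine set of the tuple `x ↦ A i x + v i`: it is non-empty, compact, and equal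
to the union of its images under the maps. -/
structure IsSelfAffineSet {J : Type*} (A : J → Mat) (v : J → Plane) (X : Set Plane) : Prop where
  nonempty : X.Nonempty
  isCompact : IsCompact X
  eq_iUnion : X = ⋃ i, affMap (A i) (v i) '' X

/-! ### The projective line, irreducibility and domination -/

/-- The real projective line: lines through the origin in the plane. -/
abbrev RP1 : Type := Projectivization ℝ Plane

/-- The quotient topology on the projective line. -/
instance : TopologicalSpace RP1 :=
  TopologicalSpace.coinduced (Projectivization.mk' ℝ : {x : Plane // x ≠ 0} → RP1) inferInstance

/-- No line through the origin is mapped into itself by all the matrices. -/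
def IsIrreducible {J : Type*} (A : J → Mat) : Prop :=
  ¬ ∃ V : RP1, ∀ i, V.submodule.map (lin (A i)) ≤ V.submodule

/-- The closed projective interval of lines spanned by `(cos t, sin t)`, `a ≤ t ≤ b`. -/
def projInterval (a b : ℝ) : Set RP1 :=
  {V | ∃ t ∈ Set.Icc a b, V.submodule = Submodule.span ℝ {!₂[Real.cos t, Real.sin t]}}

/-- A multicone: a proper subset of the projective line which is the union of a finite non-empty
family of closed projective intervals, none of which is a single point or the whole line. -/
def IsMulticone (C : Set RP1) : Prop :=
  C ≠ Set.univ ∧ ∃ (n : ℕ) (a b : Fin (n + 1) → ℝ),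
    (∀ k, a k < b k ∧ b k < a k + Real.pi) ∧ C = ⋃ k, projInterval (a k) (b k)

/-- Every matrix is non-zero and there is a multicone `C` which each matrix maps into the interior
of `C`; in particular the image of a line in `C` is a line. -/
def IsDominated {J : Type*} (A : J → Mat) : Prop :=
  (∀ i, A i ≠ 0) ∧ ∃ C : Set RP1, IsMulticone C ∧
    ∀ i, ∀ V ∈ C, ∃ W ∈ interior C, V.submodule.map (lin (A i)) = W.submodule

/-! ### Singular value function, pressure and affinity dimension -/

/-- The larger singular value. -/
def alpha1 (A : Mat) : ℝ := (lin A).singularValues 0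

/-- The smaller singular value. -/
def alpha2 (A : Mat) : ℝ := (lin A).singularValues 1

/-- The singular value function `φ^s(A)`; here `0 ^ 0 = 1`. -/
def singularValueFunction (s : ℝ≥0) (A : Mat) : ℝ :=
  if s ≤ 1 then alpha1 A ^ (s : ℝ)
  else if s ≤ 2 then alpha1 A * alpha2 A ^ ((s : ℝ) - 1)
  else |A.det| ^ ((s : ℝ) / 2)

/-- The product `A_{i_1} ⋯ A_{i_n}` along a word `i_1 ⋯ i_n`. -/
def wordProd {J : Type*} (A : J → Mat) {n : ℕ} (w : Fin n → J) : Mat :=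
  (List.ofFn fun k => A (w k)).prod

/-- The set `Γ_n` of the initial words of length `n` of the infinite words in `Γ`. -/
def prefixes {J : Type*} (Γ : Set (ℕ → J)) (n : ℕ) : Set (Fin n → J) :=
  {w | ∃ j ∈ Γ, ∀ k : Fin n, w k = j k}

open Classical in
/-- The sum of `φ^s(A_w)` over the words `w` in `Γ_n`. -/
def wordSum {J : Type*} [Fintype J] (Γ : Set (ℕ → J)) (A : J → Mat) (s : ℝ≥0) (n : ℕ) : ℝ≥0∞ :=
  ∑ w : Fin n → J with w ∈ prefixes Γ n, ENNReal.ofReal (singularValueFunction s (wordProd A w))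

/-- The pressure `P(Γ, A, s) = inf_{n ≥ 1} (1/n) log ∑_{w ∈ Γ_n} φ^s(A_w)`, valued in
`[-∞, ∞]`. For shift-invariant `Γ` the sequence of logarithms is subadditive, so that the infimum
is also the limit as `n → ∞`. -/
def pressure {J : Type*} [Fintype J] (Γ : Set (ℕ → J)) (A : J → Mat) (s : ℝ≥0) : EReal :=
  ⨅ (n : ℕ) (_ : 1 ≤ n), ENNReal.log (wordSum Γ A s n) / ((n : ℝ) : EReal)

/-- The affinity dimension `inf {s ≥ 0 : P(Γ, A, s) ≤ 0}`. -/
def affinityDim {J : Type*} [Fintype J] (Γ : Set (ℕ → J)) (A : J → Mat) : ℝ≥0∞ :=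
  ⨅ (s : ℝ≥0) (_ : pressure Γ A s ≤ 0), (s : ℝ≥0∞)

/-- The set `I^ℕ` of infinite words over `I = {i ∈ J : A i is invertible}`. -/
def invertibleWords {J : Type*} (A : J → Mat) : Set (ℕ → J) :=
  {j | ∀ n, IsUnit (A (j n))}

/-! ### Upper Minkowski dimension -/

/-- The upper Minkowski dimension `limsup_{r ↓ 0} log N(E, r) / log (1 / r)`, where `N(E, r)` is the
least number of closed balls of radius `r` needed to cover `E`. -/
def upperMinkowskiDim (E : Set Plane) : EReal :=
  Filter.limsup
    (fun r : ℝ≥0 => ENNReal.log (Metric.externalCoveringNumber r E : ℝ≥0∞) /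
      ((Real.log (1 / (r : ℝ)) : ℝ) : EReal))
    (nhdsWithin 0 (Set.Ioi 0))

end PlanarAffine

end

noncomputable section

namespace PlanarAffine

open scoped Matrix.Norms.L2Operator

/-! Only exponents `s ≤ 1` matter, and there `φ^s(A) = ‖A‖ ^ s`. Let `Y_n(s)` and `Z_n(s)` be the
sums of `‖A_w‖ ^ s` over the words of length `n` in the invertible letters and in all letters, and
let `s₀ < 1` be the affinity dimension of the invertible part. The point is that a non-zero singular
letter raises the affinity dimension strictly above `s₀`.

Irreducibility or domination makes the norm quasi-multiplicative: `‖M N‖`, or `‖M A_i N‖` for some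
letter `i`, is at least a constant times `‖M‖ ‖N‖`. Hence `Z_{m+n} ≥ c Z_m Z_n`, so a single length
with `c Z_n(s) > 1` forces positive pressure at every exponent below `s`
(`IsQuasiMultiplicative.le_affinityDim`).

To find such a length, note that `Y_n(s₀) ≥ 1` for all `n` (`one_le_wordNormSum_affinityDim`).
Sorting words by the position of their first singular letter gives about `n` disjoint classes, each
contributing on average at least a fixed amount to `Z_{n+1}`, so `Z` grows at least linearly
(`IsQuasiMultiplicative.linear_growth`). Fix `n` large; only finitely many continuous functions
`Y_m` enter, so the estimate persists at some `s > s₀`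
(`IsQuasiMultiplicative.exists_le_affinityDim`).

Finally, for `s₀ < s ≤ 1` some `Y_n(s)` is at most 1, and covering `X` by its images under words of
length `n`, iterated, bounds the upper Minkowski dimension by `s`
(`IsSelfAffineSet.upperMinkowskiDim_le`). Choosing `s` strictly between the two affinity dimensions
concludes. -/

theorem norm_lin_le (A : Mat) (x : Plane) : ‖lin A x‖ ≤ ‖A‖ * ‖x‖ :=
  (Matrix.toEuclideanCLM (n := Fin 2) (𝕜 := ℝ) A).le_opNorm x

theorem norm_le_of_forall_lin {A : Mat} {c : ℝ} (hc : 0 ≤ c) (h : ∀ x, ‖lin A x‖ ≤ c * ‖x‖) :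
    ‖A‖ ≤ c :=
  (Matrix.toEuclideanCLM (n := Fin 2) (𝕜 := ℝ) A).opNorm_le_bound hc h

theorem lin_mul (A B : Mat) (x : Plane) : lin (A * B) x = lin A (lin B x) :=
  congrArg (fun T : Plane →L[ℝ] Plane => T x)
    (map_mul (Matrix.toEuclideanCLM (n := Fin 2) (𝕜 := ℝ)) A B)

theorem lin_one (x : Plane) : lin 1 x = x :=
  congrArg (fun T : Plane →L[ℝ] Plane => T x)
    (map_one (Matrix.toEuclideanCLM (n := Fin 2) (𝕜 := ℝ)))

theorem continuous_lin (A : Mat) : Continuous (lin A) :=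
  (Matrix.toEuclideanCLM (n := Fin 2) (𝕜 := ℝ) A).continuous

/-- In an orthonormal eigenbasis of the Gram operator, `‖A x‖ ^ 2` is a weighted sum of squared
coordinates, maximal on the first basis vector because the eigenvalues are listed in decreasing
order. -/
theorem alpha1_eq_norm (A : Mat) : alpha1 A = ‖A‖ := by
  have hn : Module.finrank ℝ Plane = 2 := by simp
  have hpos := (lin A).isPositive_adjoint_comp_self
  have hsym := (lin A).isSymmetric_adjoint_comp_self
  set b := hsym.eigenvectorBasis hn with hb
  have h0 : alpha1 A ^ 2 = hsym.eigenvalues hn 0 := (lin A).sq_singularValues_fin hn 0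
  have ha : 0 ≤ alpha1 A := (lin A).singularValues_nonneg 0
  have key : ∀ x : Plane, ‖lin A x‖ ^ 2 = ∑ i, hsym.eigenvalues hn i * inner ℝ (b i) x ^ 2 := by
    intro x
    rw [← real_inner_self_eq_norm_sq, ← LinearMap.adjoint_inner_left, ← LinearMap.comp_apply,
      ← b.sum_inner_mul_inner]
    refine Finset.sum_congr rfl fun i _ => ?_
    rw [hsym, hb, hsym.apply_eigenvectorBasis hn i, inner_smul_right, real_inner_comm x]
    simp only [RCLike.ofReal_real_eq_id, id_eq]
    ring
  apply le_antisymm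
  · have h1 := key (b 0)
    have h2 : ‖lin A (b 0)‖ ^ 2 = hsym.eigenvalues hn 0 := by
      rw [h1, Finset.sum_eq_single 0]
      · simp
      · intro i _ hi
        simp [b.inner_eq_zero hi]
      · simp
    have h3 : ‖lin A (b 0)‖ = alpha1 A :=
      (sq_eq_sq₀ (norm_nonneg _) ha).1 (h2.trans h0.symm)
    rw [← h3]
    simpa using norm_lin_le A (b 0)
  · refine norm_le_of_forall_lin ha fun x => ?_
    refine (sq_le_sq₀ (norm_nonneg _) (by positivity)).1 ?_
    rw [key, mul_pow, h0, ← b.sum_sq_inner_right x, Finset.mul_sum]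
    refine Finset.sum_le_sum fun i _ => ?_
    exact mul_le_mul_of_nonneg_right (hsym.eigenvalues_antitone hn (Fin.zero_le i)) (sq_nonneg _)

theorem singularValueFunction_of_le_one {s : ℝ≥0} (hs : s ≤ 1) (A : Mat) :
    singularValueFunction s A = ‖A‖ ^ (s : ℝ) := by
  rw [singularValueFunction, if_pos hs, alpha1_eq_norm]

/-! ### Products along words and sums of powers of their norms -/

section Words

variable {K : Type*} (A : K → Mat)

theorem wordProd_zero (w : Fin 0 → K) : wordProd A w = 1 := by simp [wordProd]

theorem wordProd_cons {n : ℕ} (i : K) (w : Fin n → K) :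
    wordProd A (Fin.cons i w : Fin (n + 1) → K) = A i * wordProd A w := by
  simp [wordProd, List.ofFn_succ]

theorem wordProd_append {m n : ℕ} (u : Fin m → K) (w : Fin n → K) :
    wordProd A (Fin.append u w) = wordProd A u * wordProd A w := by
  have : (fun k => A (Fin.append u w k)) = Fin.append (fun k => A (u k)) (fun k => A (w k)) := by
    ext k : 1
    refine Fin.addCases (fun i => ?_) (fun i => ?_) k <;> simp
  rw [wordProd, this, List.ofFn_fin_append, List.prod_append, wordProd, wordProd]

theorem wordProd_snoc {n : ℕ} (w : Fin n → K) (i : K) :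
    wordProd A (Fin.snoc w i : Fin (n + 1) → K) = wordProd A w * A i := by
  rw [Fin.snoc_eq_append, wordProd_append]
  congr 1
  simp [wordProd]

theorem wordProd_mem_closure {n : ℕ} (w : Fin n → K) :
    wordProd A w ∈ Submonoid.closure (Set.range A) :=
  Submonoid.list_prod_mem _ fun M hM => by
    obtain ⟨k, rfl⟩ := (List.mem_ofFn' _ _).1 hM
    exact Submonoid.subset_closure ⟨_, rfl⟩

variable [Fintype K]

theorem sum_words_cons {n : ℕ} (f : (Fin (n + 1) → K) → ℝ) :
    ∑ w, f w = ∑ i, ∑ w : Fin n → K, f (Fin.cons i w) := by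
  rw [← Fintype.sum_prod_type', ← (Fin.consEquiv fun _ => K).sum_comp]
  rfl

theorem sum_words_snoc {n : ℕ} (f : (Fin (n + 1) → K) → ℝ) :
    ∑ w, f w = ∑ w : Fin n → K, ∑ i, f (Fin.snoc w i) := by
  rw [← Fintype.sum_prod_type_right', ← (Fin.snocEquiv fun _ => K).sum_comp]
  rfl

theorem sum_words_append {m n : ℕ} (f : (Fin (m + n) → K) → ℝ) :
    ∑ w, f w = ∑ u : Fin m → K, ∑ w : Fin n → K, f (Fin.append u w) := by
  rw [← Fintype.sum_prod_type', ← (Fin.appendEquiv m n).sum_comp]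
  rfl

/-- The sum of `‖M A_w‖ ^ s` over the words `w` of length `n`. -/
def wordNormSum (s : ℝ) (M : Mat) (n : ℕ) : ℝ := ∑ w : Fin n → K, ‖M * wordProd A w‖ ^ s

theorem wordNormSum_nonneg (s : ℝ) (M : Mat) (n : ℕ) : 0 ≤ wordNormSum A s M n :=
  Finset.sum_nonneg fun _ _ => Real.rpow_nonneg (norm_nonneg _) _

theorem wordNormSum_zero (s : ℝ) (M : Mat) : wordNormSum A s M 0 = ‖M‖ ^ s := by
  simp [wordNormSum, wordProd_zero]

theorem wordNormSum_succ (s : ℝ) (M : Mat) (n : ℕ) :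
    wordNormSum A s M (n + 1) = ∑ i, wordNormSum A s (M * A i) n := by
  simp only [wordNormSum, sum_words_cons, wordProd_cons, mul_assoc]

theorem wordNormSum_add (s : ℝ) (m n : ℕ) :
    wordNormSum A s 1 (m + n) = ∑ u : Fin m → K, wordNormSum A s (wordProd A u) n := by
  simp only [wordNormSum, sum_words_append, wordProd_append, one_mul]

theorem wordNormSum_le {s : ℝ} (hs : 0 ≤ s) (M : Mat) (n : ℕ) :
    wordNormSum A s M n ≤ ‖M‖ ^ s * wordNormSum A s 1 n := by
  simp only [wordNormSum, one_mul, Finset.mul_sum]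
  refine Finset.sum_le_sum fun w _ => ?_
  rw [← Real.mul_rpow (norm_nonneg _) (norm_nonneg _)]
  exact Real.rpow_le_rpow (norm_nonneg _) (norm_mul_le _ _) hs

theorem wordNormSum_submultiplicative {s : ℝ} (hs : 0 ≤ s) (m n : ℕ) :
    wordNormSum A s 1 (m + n) ≤ wordNormSum A s 1 m * wordNormSum A s 1 n := by
  rw [wordNormSum_add]
  refine (Finset.sum_le_sum fun u _ => wordNormSum_le A hs (wordProd A u) n).trans_eq ?_
  rw [← Finset.sum_mul]
  simp [wordNormSum]

theorem wordNormSum_mul_le {s : ℝ} (hs : 0 ≤ s) (n k : ℕ) :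
    wordNormSum A s 1 (n * k) ≤ wordNormSum A s 1 n ^ k := by
  induction k with
  | zero => simp [wordNormSum_zero]
  | succ k ih =>
    rw [Nat.mul_succ, pow_succ]
    exact (wordNormSum_submultiplicative A hs _ _).trans
      (mul_le_mul_of_nonneg_right ih (wordNormSum_nonneg _ _ _ _))

theorem wordNormSum_succ_le {s : ℝ} (hs : 0 ≤ s) (hA : ∀ i, ‖A i‖ ≤ 1) (M : Mat) (n : ℕ) :
    wordNormSum A s M (n + 1) ≤ Fintype.card K * wordNormSum A s M n := by
  simp only [wordNormSum, sum_words_snoc, wordProd_snoc, Finset.mul_sum]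
  refine Finset.sum_le_sum fun w _ => ?_
  rw [← nsmul_eq_mul, ← Finset.card_univ, ← Finset.sum_const]
  refine Finset.sum_le_sum fun i _ => Real.rpow_le_rpow (norm_nonneg _) ?_ hs
  rw [← mul_assoc]
  exact (norm_mul_le _ _).trans (mul_le_of_le_one_right (norm_nonneg _) (hA i))

end Words

/-- Quasi-multiplicativity of the norm on the semigroup generated by a tuple of matrices. -/
def IsQuasiMultiplicative {J : Type*} (A : J → Mat) (δ : ℝ) : Prop :=
  ∀ M ∈ Submonoid.closure (Set.range A), ∀ N ∈ Submonoid.closure (Set.range A),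
    δ * ‖M‖ * ‖N‖ ≤ ‖M * N‖ ∨ ∃ i, δ * ‖M‖ * ‖N‖ ≤ ‖M * A i * N‖

/-! ### Growth of the sums for quasi-multiplicative tuples -/

section Growth

variable {J : Type*} [Fintype J] {A : J → Mat} {δ s : ℝ}

/-- Adding up all alternatives avoids choosing one; `δ ≤ δ ^ s` keeps the constant independent of
`s`. -/
theorem IsQuasiMultiplicative.rpow_le (h : IsQuasiMultiplicative A δ) (hδ : 0 < δ) (hδ1 : δ ≤ 1)
    (hs : 0 < s) (hs1 : s ≤ 1) {M N : Mat} (hM : M ∈ Submonoid.closure (Set.range A))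
    (hN : N ∈ Submonoid.closure (Set.range A)) :
    δ * ‖M‖ ^ s * ‖N‖ ^ s ≤ ‖M * N‖ ^ s + ∑ i, ‖M * A i * N‖ ^ s := by
  have h1 : δ * ‖M‖ ^ s * ‖N‖ ^ s ≤ (δ * ‖M‖ * ‖N‖) ^ s := by
    rw [Real.mul_rpow (by positivity) (norm_nonneg _), Real.mul_rpow hδ.le (norm_nonneg _)]
    gcongr
    exact Real.self_le_rpow_of_le_one hδ.le hδ1 hs1
  have h2 : ∀ i, 0 ≤ ‖M * A i * N‖ ^ s := fun i => Real.rpow_nonneg (norm_nonneg _) _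
  rcases h M hM N hN with h3 | ⟨i, h3⟩
  · exact h1.trans ((Real.rpow_le_rpow (by positivity) h3 hs.le).trans
      (le_add_of_nonneg_right (Finset.sum_nonneg fun i _ => h2 i)))
  · refine h1.trans ((Real.rpow_le_rpow (by positivity) h3 hs.le).trans ?_)
    exact (Finset.single_le_sum (fun i _ => h2 i) (Finset.mem_univ i)).trans
      (le_add_of_nonneg_left (Real.rpow_nonneg (norm_nonneg _) _))

theorem IsQuasiMultiplicative.le_wordNormSum (h : IsQuasiMultiplicative A δ) (hδ : 0 < δ)
    (hδ1 : δ ≤ 1) (hA : ∀ i, ‖A i‖ ≤ 1) (hs : 0 < s) (hs1 : s ≤ 1) {M : Mat}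
    (hM : M ∈ Submonoid.closure (Set.range A)) (n : ℕ) :
    δ / (1 + Fintype.card J) * (‖M‖ ^ s * wordNormSum A s 1 n) ≤ wordNormSum A s M n := by
  -- The possible connecting letter brings in words of length `n + 1`; their sum is at most `card J`
  -- times the sum for length `n`, whence the factor `1 + card J`.
  have h1 : δ * (‖M‖ ^ s * wordNormSum A s 1 n) ≤
      wordNormSum A s M n + wordNormSum A s M (n + 1) := by
    have : wordNormSum A s M n + wordNormSum A s M (n + 1) =
        ∑ w : Fin n → J, (‖M * wordProd A w‖ ^ s + ∑ i, ‖M * A i * wordProd A w‖ ^ s) := by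
      rw [wordNormSum_succ, Finset.sum_add_distrib, Finset.sum_comm]
      rfl
    rw [this]
    simp only [wordNormSum, Finset.mul_sum]
    refine Finset.sum_le_sum fun w _ => ?_
    rw [one_mul, ← mul_assoc]
    exact h.rpow_le hδ hδ1 hs hs1 hM (wordProd_mem_closure A w)
  rw [div_mul_eq_mul_div, div_le_iff₀ (by positivity)]
  linarith [wordNormSum_succ_le A hs.le hA M n]

theorem IsQuasiMultiplicative.mul_le_wordNormSum_add (h : IsQuasiMultiplicative A δ) (hδ : 0 < δ)
    (hδ1 : δ ≤ 1) (hA : ∀ i, ‖A i‖ ≤ 1) (hs : 0 < s) (hs1 : s ≤ 1) (m n : ℕ) :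
    δ / (1 + Fintype.card J) * (wordNormSum A s 1 m * wordNormSum A s 1 n) ≤
      wordNormSum A s 1 (m + n) := by
  rw [wordNormSum_add]
  refine le_trans (le_of_eq ?_) (Finset.sum_le_sum fun u _ =>
    h.le_wordNormSum hδ hδ1 hA hs hs1 (wordProd_mem_closure A u) n)
  rw [← Finset.mul_sum, ← Finset.sum_mul]
  simp [wordNormSum]

theorem IsQuasiMultiplicative.pow_le_wordNormSum_mul (h : IsQuasiMultiplicative A δ) (hδ : 0 < δ)
    (hδ1 : δ ≤ 1) (hA : ∀ i, ‖A i‖ ≤ 1) (hs : 0 < s) (hs1 : s ≤ 1) (n k : ℕ) :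
    (δ / (1 + Fintype.card J) * wordNormSum A s 1 n) ^ k ≤ wordNormSum A s 1 (n * k) := by
  set c := δ / (1 + (Fintype.card J : ℝ)) with hc
  have hc0 : 0 ≤ c := by positivity
  induction k with
  | zero => simp [wordNormSum_zero]
  | succ k ih =>
    rw [Nat.mul_succ, pow_succ]
    refine le_trans ?_ (h.mul_le_wordNormSum_add hδ hδ1 hA hs hs1 _ _)
    have := mul_le_mul_of_nonneg_right ih (mul_nonneg hc0 (wordNormSum_nonneg A s 1 n))
    linarith

variable (A s) in
/-- The sum of `‖A_u A_w‖ ^ s` over the words `u` of length `p` in the letters with property `P`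
and all words `w` of length `n`. -/
def splitSum (P : J → Prop) [DecidablePred P] (p n : ℕ) : ℝ :=
  ∑ u : Fin p → {j // P j}, wordNormSum A s (wordProd (fun j : {j // P j} => A j) u) n

variable (A s) in
/-- The sum of `‖A_u A_j‖ ^ s` over the words `u` of length `p` in the letters with property `P`
and the letters `j` without it. -/
def exitSum (P : J → Prop) [DecidablePred P] (p : ℕ) : ℝ :=
  ∑ u : Fin p → {j // P j}, ∑ j : {j // ¬ P j},
    ‖wordProd (fun j : {j // P j} => A j) u * A j‖ ^ s

variable {P : J → Prop} [DecidablePred P]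

theorem exitSum_nonneg (p : ℕ) : 0 ≤ exitSum A s P p :=
  Finset.sum_nonneg fun _ _ => Finset.sum_nonneg fun _ _ => Real.rpow_nonneg (norm_nonneg _) _

theorem splitSum_zero_left (n : ℕ) : splitSum A s P 0 n = wordNormSum A s 1 n := by
  simp [splitSum, wordProd_zero]

theorem splitSum_zero_right (p : ℕ) :
    splitSum A s P p 0 = wordNormSum (fun j : {j // P j} => A j) s 1 p := by
  simp only [splitSum, wordNormSum_zero]
  simp only [wordNormSum, one_mul]

omit [Fintype J] [DecidablePred P] in
theorem wordProd_subtype_mem_closure {p : ℕ} (u : Fin p → {j // P j}) :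
    wordProd (fun j : {j // P j} => A j) u ∈ Submonoid.closure (Set.range A) :=
  wordProd_mem_closure A fun k => (u k : J)

theorem splitSum_succ (p n : ℕ) :
    splitSum A s P p (n + 1) = splitSum A s P (p + 1) n +
      ∑ u : Fin p → {j // P j}, ∑ j : {j // ¬ P j},
        wordNormSum A s (wordProd (fun j : {j // P j} => A j) u * A j) n := by
  simp only [splitSum, wordNormSum_succ, sum_words_snoc, wordProd_snoc]
  rw [← Finset.sum_add_distrib]
  refine Finset.sum_congr rfl fun u _ => ?_
  exact (Fintype.sum_subtype_add_sum_subtype P _).symm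

/-- The letter after the prefix either has property `P`, which lengthens the prefix, or is an exit,
after which the remaining word decouples up to a constant. -/
theorem IsQuasiMultiplicative.le_splitSum_succ (h : IsQuasiMultiplicative A δ) (hδ : 0 < δ)
    (hδ1 : δ ≤ 1) (hA : ∀ i, ‖A i‖ ≤ 1) (hs : 0 < s) (hs1 : s ≤ 1) (p n : ℕ) :
    splitSum A s P (p + 1) n +
        δ / (1 + Fintype.card J) * (exitSum A s P p * wordNormSum A s 1 n) ≤
      splitSum A s P p (n + 1) := by
  rw [splitSum_succ, exitSum, Finset.sum_mul, Finset.mul_sum]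
  gcongr with u
  rw [Finset.sum_mul, Finset.mul_sum]
  gcongr with j
  exact h.le_wordNormSum hδ hδ1 hA hs hs1
    (mul_mem (wordProd_subtype_mem_closure u) (Submonoid.subset_closure ⟨_, rfl⟩)) n

theorem le_sum_subtype_not {f : J → ℝ} (hf : ∀ j, 0 ≤ f j) {i₀ : J} (hi₀ : ¬ P i₀) :
    f i₀ ≤ ∑ j : {j // ¬ P j}, f j :=
  Finset.single_le_sum (f := fun j : {j // ¬ P j} => f j) (fun j _ => hf j)
    (Finset.mem_univ ⟨i₀, hi₀⟩)

/-- Connect `M` to `A i₀`. With no connecting letter, or with one outside `P`, an exit occurs right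
after `M`; these two cases account for the factor 2. With a connecting letter in `P` the exit comes
one step later. -/
theorem IsQuasiMultiplicative.le_sum_exit (h : IsQuasiMultiplicative A δ) (hδ : 0 < δ)
    (hδ1 : δ ≤ 1) (hA : ∀ i, ‖A i‖ ≤ 1) (hs : 0 < s) (hs1 : s ≤ 1) {i₀ : J} (hi₀ : ¬ P i₀)
    {M : Mat} (hM : M ∈ Submonoid.closure (Set.range A)) :
    δ * ‖A i₀‖ * ‖M‖ ^ s ≤ 2 * ∑ j : {j // ¬ P j}, ‖M * A j‖ ^ s +
      ∑ i : {j // P j}, ∑ j : {j // ¬ P j}, ‖M * A i * A j‖ ^ s := by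
  have hB : ‖A i₀‖ ≤ ‖A i₀‖ ^ s :=
    Real.self_le_rpow_of_le_one (norm_nonneg _) (hA i₀) hs1
  have h0 : ∀ M : Mat, 0 ≤ ‖M‖ ^ s := fun M => Real.rpow_nonneg (norm_nonneg _) _
  have h1 := h.rpow_le hδ hδ1 hs hs1 (M := M) (N := A i₀) hM (Submonoid.subset_closure ⟨_, rfl⟩)
  have h2 : ∑ i, ‖M * A i * A i₀‖ ^ s = ∑ i : {j // P j}, ‖M * A i * A i₀‖ ^ s +
      ∑ j : {j // ¬ P j}, ‖M * A j * A i₀‖ ^ s :=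
    (Fintype.sum_subtype_add_sum_subtype P _).symm
  have hsingle : ∀ N : Mat, ‖N * A i₀‖ ^ s ≤ ∑ j : {j // ¬ P j}, ‖N * A j‖ ^ s := fun N =>
    le_sum_subtype_not (f := fun j => ‖N * A j‖ ^ s) (fun j => h0 _) hi₀
  have h3 : ∑ j : {j // ¬ P j}, ‖M * A j * A i₀‖ ^ s ≤ ∑ j : {j // ¬ P j}, ‖M * A j‖ ^ s :=
    Finset.sum_le_sum fun j _ => Real.rpow_le_rpow (norm_nonneg _)
      ((norm_mul_le _ _).trans (mul_le_of_le_one_right (norm_nonneg _) (hA _))) hs.le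
  have h4 : ∑ i : {j // P j}, ‖M * A i * A i₀‖ ^ s ≤
      ∑ i : {j // P j}, ∑ j : {j // ¬ P j}, ‖M * A i * A j‖ ^ s :=
    Finset.sum_le_sum fun i _ => hsingle (M * A i)
  have h5 : δ * ‖A i₀‖ * ‖M‖ ^ s ≤ δ * ‖M‖ ^ s * ‖A i₀‖ ^ s := by
    rw [mul_assoc, mul_assoc, mul_comm (‖M‖ ^ s)]
    exact mul_le_mul_of_nonneg_left (mul_le_mul_of_nonneg_right hB (h0 _)) hδ.le
  rw [h2] at h1
  rw [two_mul]
  calc δ * ‖A i₀‖ * ‖M‖ ^ s ≤ _ := h5.trans h1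
    _ ≤ _ := add_le_add (hsingle M) (add_le_add h4 h3)
    _ = _ := by ring

theorem IsQuasiMultiplicative.le_exitSum (h : IsQuasiMultiplicative A δ) (hδ : 0 < δ)
    (hδ1 : δ ≤ 1) (hA : ∀ i, ‖A i‖ ≤ 1) (hs : 0 < s) (hs1 : s ≤ 1) {i₀ : J} (hi₀ : ¬ P i₀)
    (p : ℕ) :
    δ * ‖A i₀‖ * wordNormSum (fun j : {j // P j} => A j) s 1 p ≤
      2 * exitSum A s P p + exitSum A s P (p + 1) := by
  have h1 : exitSum A s P (p + 1) = ∑ u : Fin p → {j // P j}, ∑ i : {j // P j},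
      ∑ j : {j // ¬ P j}, ‖wordProd (fun j : {j // P j} => A j) u * A i * A j‖ ^ s := by
    simp only [exitSum, sum_words_snoc, wordProd_snoc]
  rw [h1, exitSum, Finset.mul_sum, ← Finset.sum_add_distrib, wordNormSum, Finset.mul_sum]
  refine Finset.sum_le_sum fun u _ => ?_
  rw [one_mul]
  exact h.le_sum_exit hδ hδ1 hA hs hs1 hi₀ (wordProd_subtype_mem_closure u)

/-- If the sums over the words in the letters with property `P` stay bounded away from zero, then a
further non-zero letter makes the sums over all words grow linearly. -/
theorem IsQuasiMultiplicative.linear_growth (h : IsQuasiMultiplicative A δ) (hδ : 0 < δ)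
    (hδ1 : δ ≤ 1) (hA : ∀ i, ‖A i‖ ≤ 1) (hs : 0 < s) (hs1 : s ≤ 1) {i₀ : J} (hi₀ : ¬ P i₀) {n : ℕ}
    (hY : ∀ m ≤ n + 1, 1 / 2 ≤ wordNormSum (fun j : {j // P j} => A j) s 1 m) :
    δ / (1 + Fintype.card J) * (δ * ‖A i₀‖) * n / 12 ≤ wordNormSum A s 1 (n + 1) := by
  set c := δ / (1 + (Fintype.card J : ℝ)) with hc
  have hc0 : 0 ≤ c := by positivity
  -- Discarding the exit terms leaves the words that never exit.
  have hT : ∀ q p, splitSum A s P (p + q) 0 ≤ splitSum A s P p q := by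
    intro q
    induction q with
    | zero => intro p; simp
    | succ q ih =>
      intro p
      have h1 := h.le_splitSum_succ (P := P) hδ hδ1 hA hs hs1 p q
      have h2 := ih (p + 1)
      rw [show p + 1 + q = p + (q + 1) by ring] at h2
      have h3 : 0 ≤ c * (exitSum A s P p * wordNormSum A s 1 q) :=
        mul_nonneg hc0 (mul_nonneg (exitSum_nonneg p) (wordNormSum_nonneg _ _ _ _))
      linarith
  have hZ : ∀ m ≤ n + 1, 1 / 2 ≤ wordNormSum A s 1 m := by
    intro m hm
    have h1 := hT m 0
    rw [splitSum_zero_left, zero_add, splitSum_zero_right] at h1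
    exact (hY m hm).trans h1
  -- Now the exit terms are kept: each exit is followed by a free word whose sum is at least `1 /
  -- 2`.
  have hsum : ∀ q p, p + q ≤ n + 1 →
      c / 2 * ∑ k ∈ Finset.range q, exitSum A s P (p + k) ≤ splitSum A s P p q := by
    intro q
    induction q with
    | zero =>
      intro p _
      simpa [splitSum] using Finset.sum_nonneg fun u _ => wordNormSum_nonneg A s _ 0
    | succ q ih =>
      intro p hp
      have h1 := h.le_splitSum_succ (P := P) hδ hδ1 hA hs hs1 p q
      have h2 := ih (p + 1) (by omega)
      have h3 : c * (exitSum A s P p * (1 / 2)) ≤ c * (exitSum A s P p * wordNormSum A s 1 q) :=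
        mul_le_mul_of_nonneg_left (mul_le_mul_of_nonneg_left (hZ q (by omega))
          (exitSum_nonneg p)) hc0
      rw [Finset.sum_range_succ', mul_add]
      simp only [add_assoc, add_comm 1, add_zero] at h2 ⊢
      linarith
  have h1 := hsum (n + 1) 0 (by omega)
  rw [splitSum_zero_left] at h1
  simp only [zero_add] at h1
  refine le_trans ?_ h1
  -- A single exit sum may be small, but `2 E_k + E_{k+1}` is not; summing over `k < n` counts each
  -- exit sum at most three times.
  have h2 : (n : ℝ) * (δ * ‖A i₀‖ * (1 / 2)) ≤
      3 * ∑ k ∈ Finset.range (n + 1), exitSum A s P k := by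
    have h3 : ∑ k ∈ Finset.range n, (δ * ‖A i₀‖ * (1 / 2)) ≤
        ∑ k ∈ Finset.range n, (2 * exitSum A s P k + exitSum A s P (k + 1)) := by
      refine Finset.sum_le_sum fun k hk => ?_
      refine le_trans ?_ (h.le_exitSum hδ hδ1 hA hs hs1 hi₀ k)
      exact mul_le_mul_of_nonneg_left (hY k (by have := Finset.mem_range.1 hk; omega))
        (by positivity)
    rw [Finset.sum_const, Finset.card_range, nsmul_eq_mul, Finset.sum_add_distrib,
      ← Finset.mul_sum] at h3
    have h4 := Finset.sum_range_succ (exitSum A s P) n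
    have h5 := Finset.sum_range_succ' (exitSum A s P) n
    have h6 := exitSum_nonneg (A := A) (s := s) (P := P) n
    have h7 := exitSum_nonneg (A := A) (s := s) (P := P) 0
    linarith
  have h8 := mul_le_mul_of_nonneg_left h2 hc0
  linarith

end Growth

/-! ### Determinants of pairs of vectors in the plane -/

section Plane

theorem real_inner_plane (x y : Plane) : inner ℝ x y = x 0 * y 0 + x 1 * y 1 := by
  simp [PiLp.inner_apply, Fin.sum_univ_two, mul_comm]

theorem norm_sq_plane (x : Plane) : ‖x‖ ^ 2 = x 0 ^ 2 + x 1 ^ 2 := by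
  rw [← real_inner_self_eq_norm_sq, real_inner_plane]
  ring

/-- The determinant of a pair of vectors in the plane. -/
def cross (x y : Plane) : ℝ := x 0 * y 1 - x 1 * y 0

theorem cross_add_smul (x z e : Plane) (t : ℝ) :
    cross (x + t • z) e = cross x e + t * cross z e := by
  simp [cross]
  ring

theorem abs_cross_le (x y : Plane) : |cross x y| ≤ ‖x‖ * ‖y‖ := by
  refine abs_le_of_sq_le_sq ?_ (by positivity)
  rw [mul_pow, norm_sq_plane, norm_sq_plane, cross]
  nlinarith [sq_nonneg (x 0 * y 0 + x 1 * y 1)]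

theorem cross_smul (e e' y : Plane) :
    cross e e' • y = cross y e' • e - cross y e • e' := by
  ext i
  fin_cases i <;> simp [cross] <;> ring

theorem exists_smul_of_cross_eq_zero {x y : Plane} (hy : y ≠ 0) (h : cross x y = 0) :
    ∃ r : ℝ, x = r • y := by
  have hy' : y 0 ^ 2 + y 1 ^ 2 ≠ 0 := by
    rw [← norm_sq_plane]
    exact pow_ne_zero _ (norm_ne_zero_iff.2 hy)
  refine ⟨(x 0 * y 0 + x 1 * y 1) / (y 0 ^ 2 + y 1 ^ 2), ?_⟩
  unfold cross at h
  ext i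
  fin_cases i <;> simp <;> field_simp
  · linear_combination y 1 * h
  · linear_combination -(y 0) * h

theorem exists_unit_norm_eq (T : Plane →L[ℝ] Plane) : ∃ x : Plane, ‖x‖ = 1 ∧ ‖T x‖ = ‖T‖ := by
  obtain ⟨x, hx, hmax⟩ := (isCompact_sphere (0 : Plane) 1).exists_isMaxOn
    (NormedSpace.sphere_nonempty.2 zero_le_one) (T.continuous.norm.continuousOn)
  have hx1 : ‖x‖ = 1 := by simpa using hx
  refine ⟨x, hx1, le_antisymm (by simpa [hx1] using T.le_opNorm x) ?_⟩
  refine T.opNorm_le_of_unit_norm (norm_nonneg _) fun z hz => ?_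
  exact hmax (by simpa using hz)

end Plane

/-! ### Irreducible tuples are quasi-multiplicative -/

section Irreducible

variable {J : Type*} [Fintype J] {A : J → Mat}

/-- By homogeneity and compactness it is enough that the right side never vanishes for unit vectors.
If it did, `y` and all `A i y` would be orthogonal to `z`, hence parallel in the plane, and `y`
would span an invariant line. -/
theorem IsIrreducible.exists_lower_bound (h : IsIrreducible A) :
    ∃ μ > 0, ∀ y z : Plane,
      μ * (‖y‖ * ‖z‖) ≤ |inner ℝ y z| + ∑ i, |inner ℝ (lin (A i) y) z| := by
  set g : Plane × Plane → ℝ := fun q => |inner ℝ q.1 q.2| + ∑ i, |inner ℝ (lin (A i) q.1) q.2|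
    with hg
  have hcont : Continuous g := by
    have := fun i => continuous_lin (A i)
    fun_prop
  have hcpt : IsCompact (Metric.sphere (0 : Plane) 1 ×ˢ Metric.sphere (0 : Plane) 1) :=
    (isCompact_sphere _ _).prod (isCompact_sphere _ _)
  have hne : (Metric.sphere (0 : Plane) 1).Nonempty := NormedSpace.sphere_nonempty.2 zero_le_one
  obtain ⟨⟨y₀, z₀⟩, hq, hmin⟩ := hcpt.exists_isMinOn (hne.prod hne) hcont.continuousOn
  have hy₀ : y₀ ≠ 0 := Metric.ne_of_mem_sphere hq.1 one_ne_zero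
  have hz₀ : z₀ ≠ 0 := Metric.ne_of_mem_sphere hq.2 one_ne_zero
  have hpos : 0 < g (y₀, z₀) := by
    have hnn : ∀ i, 0 ≤ |inner ℝ (lin (A i) y₀) z₀| := fun i => abs_nonneg _
    refine lt_of_le_of_ne (add_nonneg (abs_nonneg _) (Finset.sum_nonneg fun i _ => hnn i)) ?_
    intro h0
    have h1 := (add_eq_zero_iff_of_nonneg (abs_nonneg _)
      (Finset.sum_nonneg fun i _ => hnn i)).1 h0.symm
    have h2 := (Finset.sum_eq_zero_iff_of_nonneg fun i _ => hnn i).1 h1.2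
    refine h ⟨Projectivization.mk ℝ y₀ hy₀, fun i => ?_⟩
    rw [Projectivization.submodule_mk, Submodule.map_span, Set.image_singleton,
      Submodule.span_singleton_le_iff_mem, Submodule.mem_span_singleton]
    have h3 := abs_eq_zero.1 h1.1
    have h4 := abs_eq_zero.1 (h2 i (Finset.mem_univ i))
    simp only [real_inner_plane] at h3 h4
    have h5 : cross (lin (A i) y₀) y₀ = 0 := by
      have hz' : z₀ 0 ≠ 0 ∨ z₀ 1 ≠ 0 := by
        by_contra! hz
        exact hz₀ (by ext i; fin_cases i <;> simp [hz.1, hz.2])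
      unfold cross
      rcases hz' with hz | hz
      · refine mul_left_cancel₀ hz ?_
        linear_combination y₀ 1 * h4 - (lin (A i) y₀) 1 * h3
      · refine mul_left_cancel₀ hz ?_
        linear_combination (lin (A i) y₀) 0 * h3 - y₀ 0 * h4
    obtain ⟨r, hr⟩ := exists_smul_of_cross_eq_zero hy₀ h5
    exact ⟨r, hr.symm⟩
  refine ⟨g (y₀, z₀), hpos, fun y z => ?_⟩
  rcases eq_or_ne y 0 with rfl | hy
  · simp
  rcases eq_or_ne z 0 with rfl | hz
  · simp
  have hy' : 0 < ‖y‖ := norm_pos_iff.2 hy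
  have hz' : 0 < ‖z‖ := norm_pos_iff.2 hz
  have h1 : g (y₀, z₀) ≤ g (‖y‖⁻¹ • y, ‖z‖⁻¹ • z) :=
    hmin ⟨by simp [norm_smul, hy'.ne'], by simp [norm_smul, hz'.ne']⟩
  have h2 : g (‖y‖⁻¹ • y, ‖z‖⁻¹ • z) = (‖y‖ * ‖z‖)⁻¹ * g (y, z) := by
    simp only [hg, map_smul, inner_smul_left, inner_smul_right, abs_mul, mul_add, Finset.mul_sum,
      RCLike.conj_to_real, abs_inv, abs_norm, mul_inv, mul_assoc, mul_left_comm ‖z‖⁻¹]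
  rw [h2, inv_mul_eq_div, le_div_iff₀ (by positivity)] at h1
  exact h1

theorem IsIrreducible.exists_isQuasiMultiplicative (h : IsIrreducible A) :
    ∃ δ : ℝ, 0 < δ ∧ δ ≤ 1 ∧ IsQuasiMultiplicative A δ := by
  obtain ⟨μ, hμ, hle⟩ := h.exists_lower_bound
  have hcard : (0 : ℝ) < 1 + Fintype.card J := by positivity
  set δ := min 1 (μ / (1 + Fintype.card J)) with hδ
  have hδ0 : 0 < δ := lt_min one_pos (by positivity)
  refine ⟨δ, hδ0, min_le_left _ _, fun M _ N _ => ?_⟩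
  -- The lower bound is applied to `y = N x` and `z = M* p`, where `x` and `p` attain the norms of
  -- `N` and `M*`; then `⟨B y, z⟩ = ⟨M B N x, p⟩` is at most `‖M B N‖` in absolute value.
  obtain ⟨x, hx, hNx⟩ := exists_unit_norm_eq (Matrix.toEuclideanCLM (n := Fin 2) (𝕜 := ℝ) N)
  obtain ⟨p, hp, hMp⟩ := exists_unit_norm_eq
    (ContinuousLinearMap.adjoint (Matrix.toEuclideanCLM (n := Fin 2) (𝕜 := ℝ) M))
  set z := ContinuousLinearMap.adjoint (Matrix.toEuclideanCLM (n := Fin 2) (𝕜 := ℝ) M) p with hz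
  have hz' : ‖z‖ = ‖M‖ := hMp.trans (LinearIsometryEquiv.norm_map _ _)
  have hy' : ‖lin N x‖ = ‖N‖ := hNx
  have hbound : ∀ B : Mat, |inner ℝ (lin B (lin N x)) z| ≤ ‖M * B * N‖ := by
    intro B
    have h1 : inner ℝ (lin B (lin N x)) z = inner ℝ (lin (M * B * N) x) p := by
      rw [hz, ContinuousLinearMap.adjoint_inner_right, lin_mul, lin_mul]
      rfl
    rw [h1]
    refine (abs_real_inner_le_norm _ _).trans ?_
    have := norm_lin_le (M * B * N) x
    rw [hx, mul_one] at this
    rwa [hp, mul_one]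
  have h1 := hle (lin N x) z
  rw [hy', hz'] at h1
  by_contra! hcon
  obtain ⟨hc1, hc2⟩ := hcon
  have h2 := hbound 1
  rw [mul_one, lin_one] at h2
  have h3 : |inner ℝ (lin N x) z| + ∑ i, |inner ℝ (lin (A i) (lin N x)) z| <
      δ * ‖M‖ * ‖N‖ + ∑ _i : J, δ * ‖M‖ * ‖N‖ :=
    add_lt_add_of_lt_of_le (h2.trans_lt hc1)
      (Finset.sum_le_sum fun i _ => (hbound (A i)).trans (hc2 i).le)
  rw [Finset.sum_const, Finset.card_univ, nsmul_eq_mul] at h3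
  have h4 : δ * (1 + Fintype.card J) ≤ μ := (le_div_iff₀ hcard).1 (min_le_right _ _)
  have h5 := mul_le_mul_of_nonneg_right h4 (mul_nonneg (norm_nonneg N) (norm_nonneg M))
  linarith

end Irreducible

/-! ### Dominated tuples are quasi-multiplicative -/

section Dominated

variable {J : Type*}

/-- The unit vector with the given argument. -/
def unitVec (t : ℝ) : Plane := !₂[Real.cos t, Real.sin t]

theorem norm_unitVec (t : ℝ) : ‖unitVec t‖ = 1 := by
  rw [← sq_eq_sq₀ (norm_nonneg _) zero_le_one, norm_sq_plane]
  simp [unitVec]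

theorem continuous_unitVec : Continuous unitVec := by
  unfold unitVec
  refine (PiLp.continuous_toLp 2 _).comp (continuous_pi fun i => ?_)
  fin_cases i
  · exact Real.continuous_cos
  · exact Real.continuous_sin

theorem mk_eq_of_mem_submodule {x : Plane} (hx : x ≠ 0) {V : RP1} (h : x ∈ V.submodule) :
    Projectivization.mk ℝ x hx = V := by
  induction V using Projectivization.ind with
  | h v hv =>
    rw [Projectivization.submodule_mk, Submodule.mem_span_singleton] at h
    obtain ⟨r, rfl⟩ := h
    exact (Projectivization.mk_eq_mk_iff' ℝ _ _ hx hv).2 ⟨r, rfl⟩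

/-- A multicone is the set of lines spanned by a compact set of unit vectors. -/
theorem IsMulticone.exists_compact {C : Set RP1} (h : IsMulticone C) :
    ∃ D : Set Plane, IsCompact D ∧ D.Nonempty ∧ (∀ d ∈ D, ‖d‖ = 1) ∧
      ∀ V : RP1, V ∈ C ↔ ∃ d ∈ D, V.submodule = Submodule.span ℝ {d} := by
  obtain ⟨-, n, a, b, hab, rfl⟩ := h
  refine ⟨⋃ k, unitVec '' Set.Icc (a k) (b k), ?_, ?_, ?_, fun V => ?_⟩
  · exact isCompact_iUnion fun k => isCompact_Icc.image continuous_unitVec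
  · exact ⟨unitVec (a 0), Set.mem_iUnion.2 ⟨0, a 0, Set.left_mem_Icc.2 (hab 0).1.le, rfl⟩⟩
  · intro d hd
    obtain ⟨k, t, -, rfl⟩ := Set.mem_iUnion.1 hd
    exact norm_unitVec t
  · simp only [Set.mem_iUnion, projInterval, Set.mem_ofPred_eq, Set.mem_image]
    constructor
    · rintro ⟨k, t, ht, hV⟩
      exact ⟨unitVec t, ⟨k, t, ht, rfl⟩, hV⟩
    · rintro ⟨_, ⟨k, t, ht, rfl⟩, hV⟩
      exact ⟨k, t, ht, hV⟩

/-- The non-zero multiples of the elements of `D`. -/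
def coneOver (D : Set Plane) : Set Plane := {y | ∃ r : ℝ, r ≠ 0 ∧ ∃ d ∈ D, y = r • d}

/-- On the unit circle the complement of the cone is open, so a sufficiently small rotation of `e`
also avoids it. -/
theorem exists_pair_not_mem_coneOver {D : Set Plane} (hD : IsCompact D) (hD1 : ∀ d ∈ D, ‖d‖ = 1)
    {e : Plane} (he : ‖e‖ = 1) (heD : e ∉ coneOver D) :
    ∃ e' : Plane, ‖e'‖ = 1 ∧ e' ∉ coneOver D ∧ cross e e' ≠ 0 := by
  have hunit : ∀ y : Plane, ‖y‖ = 1 → (y ∈ coneOver D ↔ y ∈ D ∪ -D) := by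
    intro y hy
    constructor
    · rintro ⟨r, -, d, hd, rfl⟩
      rw [norm_smul, hD1 d hd, mul_one, Real.norm_eq_abs] at hy
      rcases eq_or_eq_neg_of_abs_eq hy with rfl | rfl
      · left; simpa using hd
      · right; simpa using hd
    · rintro (h | h)
      · exact ⟨1, one_ne_zero, y, h, by simp⟩
      · exact ⟨-1, by simp, -y, h, by simp⟩
  have hcl : IsClosed (D ∪ -D) := hD.isClosed.union hD.neg.isClosed
  let rot : ℝ → Plane := fun θ => Real.cos θ • e + Real.sin θ • !₂[-(e 1), e 0]
  have hrot : Continuous rot := by fun_prop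
  have h0 : rot 0 = e := by simp [rot]
  have he2 : e 0 ^ 2 + e 1 ^ 2 = 1 := by rw [← norm_sq_plane, he]; norm_num
  have hev : ∀ᶠ θ in nhds (0 : ℝ), rot θ ∈ (D ∪ -D)ᶜ :=
    hrot.continuousAt.eventually_mem (hcl.isOpen_compl.mem_nhds (by
      rw [h0]; exact fun h => heD ((hunit e he).2 h)))
  obtain ⟨ε, hε, hball⟩ := Metric.eventually_nhds_iff.1 hev
  set θ := min (ε / 2) 1 with hθ
  have hθ0 : 0 < θ := lt_min (by positivity) one_pos
  have hsin : 0 < Real.sin θ := Real.sin_pos_of_pos_of_lt_pi hθ0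
    ((min_le_right _ _).trans_lt (by linarith [Real.pi_gt_three]))
  have hmem := @hball θ (by
    rw [Real.dist_eq, sub_zero, abs_of_pos hθ0]
    exact (min_le_left _ _).trans_lt (by linarith))
  have hcs := Real.sin_sq_add_cos_sq θ
  have hnorm : ‖rot θ‖ = 1 := by
    rw [← sq_eq_sq₀ (norm_nonneg _) zero_le_one, norm_sq_plane]
    simp only [rot, PiLp.add_apply, PiLp.smul_apply, smul_eq_mul, Matrix.cons_val_zero,
      Matrix.cons_val_one, one_pow]
    linear_combination (Real.sin θ ^ 2 + Real.cos θ ^ 2) * he2 + hcs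
  refine ⟨rot θ, hnorm, fun h => hmem ((hunit _ hnorm).1 h), ?_⟩
  have : cross e (rot θ) = Real.sin θ := by
    simp only [cross, rot, PiLp.add_apply, PiLp.smul_apply, smul_eq_mul, Matrix.cons_val_zero,
      Matrix.cons_val_one]
    linear_combination Real.sin θ * he2
  rw [this]
  exact hsin.ne'

theorem isOpen_setOf_mk_mem {U : Set RP1} (hU : IsOpen U) :
    IsOpen {y : Plane | ∃ hy : y ≠ 0, Projectivization.mk ℝ y hy ∈ U} := by
  have h1 : IsOpen ((Projectivization.mk' ℝ : {x : Plane // x ≠ 0} → RP1) ⁻¹' U) :=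
    isOpen_coinduced.1 hU
  have h2 : IsOpen {y : Plane | y ≠ 0} := isOpen_ne
  have h3 := h2.isOpenMap_subtype_val _ h1
  convert h3 using 1
  ext y
  constructor
  · rintro ⟨hy, h⟩
    exact ⟨⟨y, hy⟩, h, rfl⟩
  · rintro ⟨⟨y, hy⟩, h, rfl⟩
    exact ⟨hy, h⟩

theorem mem_closure_mapsTo {A : J → Mat} {P : Set Plane} (h : ∀ i, ∀ y ∈ P, lin (A i) y ∈ P)
    {M : Mat} (hM : M ∈ Submonoid.closure (Set.range A)) : ∀ y ∈ P, lin M y ∈ P := by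
  induction hM using Submonoid.closure_induction with
  | mem _ hx =>
    obtain ⟨i, rfl⟩ := hx
    exact h i
  | one =>
    intro y hy
    rwa [lin_one]
  | mul M N _ _ hM hN =>
    intro y hy
    rw [lin_mul]
    exact hM _ (hN _ hy)

/-- If the matrix `M` maps the balls of radius `ε` about the points of `K` into a cone which omits
two distinct lines, then `‖M‖` is comparable with `‖M k‖` for `k ∈ K`. -/
theorem norm_le_of_mapsTo_cone {M : Mat} {k e e' : Plane} {ε : ℝ} (hε : 0 < ε) (he : ‖e‖ = 1)
    (he' : ‖e'‖ = 1) (hne : cross e e' ≠ 0)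
    (h : ∀ z : Plane, ‖z‖ ≤ ε → cross (lin M (k + z)) e ≠ 0 ∧ cross (lin M (k + z)) e' ≠ 0) :
    ‖M‖ ≤ 2 / (ε * |cross e e'|) * ‖lin M k‖ := by
  have hpos : 0 < |cross e e'| := abs_pos.2 hne
  -- Along a direction `z` the determinant with `f` is affine; without a zero within distance `ε` of
  -- `k`, its slope is at most its value at `k` divided by `ε`. Two independent `f` then control `M
  -- z`.
  have hone : ∀ f : Plane, ‖f‖ = 1 → (∀ z : Plane, ‖z‖ ≤ ε → cross (lin M (k + z)) f ≠ 0) →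
      ∀ z : Plane, ‖z‖ = 1 → ε * |cross (lin M z) f| ≤ ‖lin M k‖ := by
    intro f hf hnz z hz
    by_contra! hcon
    have h1 : |cross (lin M k) f| ≤ ‖lin M k‖ := by simpa [hf] using abs_cross_le (lin M k) f
    have h2 : 0 < |cross (lin M z) f| := by
      by_contra! h0
      have : ε * |cross (lin M z) f| ≤ 0 := mul_nonpos_of_nonneg_of_nonpos hε.le h0
      linarith [norm_nonneg (lin M k)]
    have h3 : cross (lin M z) f ≠ 0 := abs_pos.1 h2
    refine hnz ((-(cross (lin M k) f / cross (lin M z) f)) • z) ?_ ?_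
    · rw [norm_smul, hz, mul_one, norm_neg, Real.norm_eq_abs, abs_div, div_le_iff₀ h2]
      linarith
    · rw [map_add, map_smul, cross_add_smul]
      field_simp
      ring
  refine (Matrix.toEuclideanCLM (n := Fin 2) (𝕜 := ℝ) M).opNorm_le_of_unit_norm
    (by positivity) fun z hz => ?_
  change ‖lin M z‖ ≤ _
  have h1 := hone e he (fun z hz => (h z hz).1) z hz
  have h2 := hone e' he' (fun z hz => (h z hz).2) z hz
  have h3 : |cross e e'| * ‖lin M z‖ ≤ |cross (lin M z) e'| + |cross (lin M z) e| := by
    rw [← Real.norm_eq_abs (cross e e'), ← norm_smul, cross_smul]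
    refine (norm_sub_le _ _).trans_eq ?_
    simp [norm_smul, he, he']
  rw [div_mul_eq_mul_div, le_div_iff₀ (by positivity)]
  have h4 := mul_le_mul_of_nonneg_left h3 hε.le
  linarith

/-- Every product nearly attains its norm on the cone over `K`, the union of the images of `D`, and
this cone is invariant. Applying first `N` and then `M` to one vector of `K` bounds `‖M N‖` below,
so no connecting letter is needed. -/
theorem IsDominated.exists_isQuasiMultiplicative [Finite J] [Nonempty J] {A : J → Mat}
    (h : IsDominated A) : ∃ δ : ℝ, 0 < δ ∧ δ ≤ 1 ∧ IsQuasiMultiplicative A δ := by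
  obtain ⟨-, C, hC, hAC⟩ := h
  obtain ⟨D, hDc, hDne, hD1, hDC⟩ := hC.exists_compact
  have hD0 : ∀ d ∈ D, d ≠ 0 := fun d hd => norm_ne_zero_iff.1 (by rw [hD1 d hd]; exact one_ne_zero)
  set Ω : Set Plane := {y | ∃ hy : y ≠ 0, Projectivization.mk ℝ y hy ∈ interior C} with hΩ
  set K : Set Plane := ⋃ i, lin (A i) '' D with hK
  have hKc : IsCompact K := isCompact_iUnion fun i => hDc.image (continuous_lin (A i))
  have hmemC : ∀ (y : Plane) (hy : y ≠ 0), Projectivization.mk ℝ y hy ∈ C ↔ y ∈ coneOver D := by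
    intro y hy
    rw [hDC, Projectivization.submodule_mk]
    constructor
    · rintro ⟨d, hd, hyd⟩
      obtain ⟨r, rfl⟩ := Submodule.mem_span_singleton.1
        (hyd ▸ Submodule.mem_span_singleton_self y)
      exact ⟨r, fun hr => hy (by simp [hr]), d, hd, rfl⟩
    · rintro ⟨r, hr, d, hd, rfl⟩
      exact ⟨d, hd, Submodule.span_singleton_smul_eq (IsUnit.mk0 r hr) d⟩
  have hΩC : Ω ⊆ coneOver D := by
    rintro y ⟨hy, hyC⟩
    exact (hmemC y hy).1 (interior_subset hyC)
  have hKΩ : K ⊆ Ω := by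
    intro y hy
    obtain ⟨i, d, hd, rfl⟩ := Set.mem_iUnion.1 hy
    obtain ⟨W, hW, hmap⟩ := hAC i (Projectivization.mk ℝ d (hD0 d hd))
      ((hmemC d _).2 ⟨1, one_ne_zero, d, hd, by simp⟩)
    rw [Projectivization.submodule_mk, Submodule.map_span, Set.image_singleton] at hmap
    have h0 : lin (A i) d ≠ 0 := by
      intro h0
      have h1 := W.finrank_submodule
      rw [← hmap, h0, Submodule.span_zero_singleton] at h1
      simp at h1
    refine ⟨h0, ?_⟩
    rwa [mk_eq_of_mem_submodule h0 (V := W)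
      (hmap ▸ Submodule.mem_span_singleton_self _)]
  -- Strict inclusion in the interior of the multicone enters here, as a uniform radius around `K`.
  obtain ⟨ε, hε, hthick⟩ := hKc.exists_cthickening_subset_open
    (isOpen_setOf_mk_mem isOpen_interior) hKΩ
  have hAcone : ∀ i, ∀ y ∈ coneOver D, lin (A i) y ∈ coneOver D := by
    rintro i _ ⟨r, hr, d, hd, rfl⟩
    obtain ⟨r', hr', d', hd', h'⟩ := hΩC (hKΩ (Set.mem_iUnion.2 ⟨i, d, hd, rfl⟩))
    exact ⟨r * r', mul_ne_zero hr hr', d', hd', by rw [map_smul, h', smul_smul]⟩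
  have hAK : ∀ i, ∀ y ∈ coneOver K, lin (A i) y ∈ coneOver K := by
    rintro i _ ⟨r, hr, k, hk, rfl⟩
    obtain ⟨r', hr', d, hd, rfl⟩ := hΩC (hKΩ hk)
    exact ⟨r * r', mul_ne_zero hr hr', lin (A i) d, Set.mem_iUnion.2 ⟨i, d, hd, rfl⟩, by
      rw [map_smul, map_smul, smul_smul]⟩
  obtain ⟨V, hV⟩ := (Set.ne_univ_iff_exists_notMem C).1 hC.1
  have hVr : 0 < ‖V.rep‖ := norm_pos_iff.2 V.rep_nonzero
  set e : Plane := ‖V.rep‖⁻¹ • V.rep with he_def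
  have he : ‖e‖ = 1 := by rw [he_def, norm_smul, norm_inv, norm_norm, inv_mul_cancel₀ hVr.ne']
  have he0 : e ≠ 0 := norm_ne_zero_iff.1 (by rw [he]; exact one_ne_zero)
  have heV : Projectivization.mk ℝ e he0 = V := by
    refine mk_eq_of_mem_submodule he0 ?_
    rw [V.submodule_eq]
    exact Submodule.smul_mem _ _ (Submodule.mem_span_singleton_self _)
  have heD : e ∉ coneOver D := fun h => hV (heV ▸ (hmemC e he0).2 h)
  obtain ⟨e', he', he'D, hee'⟩ := exists_pair_not_mem_coneOver hDc hD1 he heD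
  have hcross : ∀ f : Plane, ‖f‖ = 1 → f ∉ coneOver D → ∀ y ∈ coneOver D, cross y f ≠ 0 := by
    rintro f hf hfD y ⟨r, hr, d, hd, rfl⟩ h0
    obtain ⟨q, hq⟩ := exists_smul_of_cross_eq_zero
      (norm_ne_zero_iff.1 (by rw [hf]; exact one_ne_zero)) h0
    have hq0 : q ≠ 0 := by
      rintro rfl
      rw [zero_smul, smul_eq_zero] at hq
      exact hq.elim hr (hD0 d hd)
    refine hfD ⟨q⁻¹ * r, mul_ne_zero (inv_ne_zero hq0) hr, d, hd, ?_⟩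
    rw [← smul_smul, hq, smul_smul, inv_mul_cancel₀ hq0, one_smul]
  obtain ⟨R, hR⟩ := hKc.isBounded.exists_norm_le
  obtain ⟨k₀, hk₀⟩ : K.Nonempty := by
    obtain ⟨d, hd⟩ := hDne
    obtain ⟨i⟩ := ‹Nonempty J›
    exact ⟨_, Set.mem_iUnion.2 ⟨i, d, hd, rfl⟩⟩
  have hk₀0 : 0 < ‖k₀‖ := norm_pos_iff.2 (hKΩ hk₀).choose
  have hR0 : 0 < R := hk₀0.trans_le (hR k₀ hk₀)
  set κ := 2 / (ε * |cross e e'|) with hκ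
  have hκ0 : 0 < κ := by have := abs_pos.2 hee'; positivity
  have hmain : ∀ M ∈ Submonoid.closure (Set.range A), ∀ y ∈ coneOver K,
      ‖M‖ * ‖y‖ ≤ κ * R * ‖lin M y‖ := by
    rintro M hM _ ⟨r, hr, k, hk, rfl⟩
    have h1 : ‖M‖ ≤ κ * ‖lin M k‖ := by
      refine norm_le_of_mapsTo_cone hε he he' hee' fun z hz => ?_
      have hmem : k + z ∈ Ω := hthick (Metric.mem_cthickening_of_dist_le _ k _ _ hk
        (by simpa [dist_eq_norm] using hz))
      have := mem_closure_mapsTo hAcone hM _ (hΩC hmem)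
      exact ⟨hcross e he heD _ this, hcross e' he' he'D _ this⟩
    rw [map_smul, norm_smul, norm_smul]
    calc ‖M‖ * (‖r‖ * ‖k‖) ≤ (κ * ‖lin M k‖) * (‖r‖ * R) := by
          gcongr
          exact hR k hk
      _ = _ := by ring
  set c := κ * R with hc
  have hc0 : 0 < c := by positivity
  refine ⟨min 1 (c ^ 2)⁻¹, lt_min one_pos (by positivity), min_le_left _ _,
    fun M hM N hN => Or.inl ?_⟩
  have hk₀' : k₀ ∈ coneOver K := ⟨1, one_ne_zero, k₀, hk₀, by simp⟩
  have h1 := hmain N hN k₀ hk₀'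
  have h2 := hmain M hM _ (mem_closure_mapsTo hAK hN k₀ hk₀')
  rw [← lin_mul] at h2
  have h3 := norm_lin_le (M * N) k₀
  have h4 : ‖M‖ * ‖N‖ * ‖k₀‖ ≤ c ^ 2 * ‖M * N‖ * ‖k₀‖ := by
    calc ‖M‖ * ‖N‖ * ‖k₀‖ = ‖M‖ * (‖N‖ * ‖k₀‖) := by ring
      _ ≤ ‖M‖ * (c * ‖lin N k₀‖) := by gcongr
      _ = c * (‖M‖ * ‖lin N k₀‖) := by ring
      _ ≤ c * (c * (‖M * N‖ * ‖k₀‖)) :=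
        mul_le_mul_of_nonneg_left (h2.trans (mul_le_mul_of_nonneg_left h3 hc0.le)) hc0.le
      _ = _ := by ring
  have h5 := le_of_mul_le_mul_right h4 hk₀0
  calc min 1 (c ^ 2)⁻¹ * ‖M‖ * ‖N‖ ≤ (c ^ 2)⁻¹ * ‖M‖ * ‖N‖ := by
        gcongr
        exact min_le_right _ _
    _ = (c ^ 2)⁻¹ * (‖M‖ * ‖N‖) := by ring
    _ ≤ ‖M * N‖ := by
      rw [inv_mul_le_iff₀ (by positivity)]
      exact h5

end Dominated

/-! ### Covers of self-affine sets and the upper Minkowski dimension -/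

section Minkowski

/-- A bounded set which is covered by finitely many of its images under contractions with ratios
`r k` such that `∑ r k ^ s ≤ 1` has covering numbers `O(ε ^ (-s))`. -/
theorem exists_cover_card_le {K E : Type*} [Fintype K] [MetricSpace E] {g : K → E → E} {r : K → ℝ}
    (hr0 : ∀ k, 0 < r k) (hr1 : ∀ k, r k < 1) (hg : ∀ k x y, dist (g k x) (g k y) ≤ r k * dist x y)
    {X : Set E} (hX : X.Nonempty) (hb : Bornology.IsBounded X) (hcover : X ⊆ ⋃ k, g k '' X)
    {s : ℝ} (hs : 0 ≤ s) (hsum : ∑ k, r k ^ s ≤ 1) :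
    ∃ R > 0, ∀ ε > 0, ε ≤ R → ∃ F : Finset E, (∀ x ∈ X, ∃ y ∈ F, dist x y ≤ ε) ∧
      (F.card : ℝ) ≤ (R / ε) ^ s := by
  classical
  obtain ⟨x₀, hx₀⟩ := hX
  obtain ⟨k₀, -⟩ := Set.mem_iUnion.1 (hcover hx₀)
  have : Nonempty K := ⟨k₀⟩
  obtain ⟨kmax, hmax⟩ := Finite.exists_max r
  obtain ⟨kmin, hmin⟩ := Finite.exists_min r
  obtain ⟨R₀', hR₀'⟩ := (Metric.isBounded_iff_subset_closedBall x₀).1 hb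
  set R₀ := max R₀' 1
  have hR₀ : 0 < R₀ := lt_max_of_lt_right one_pos
  have hball : ∀ x ∈ X, dist x x₀ ≤ R₀ := fun x hx => (hR₀' hx).trans (le_max_left _ _)
  -- With this `R`, a scale `ε < R₀` satisfies `ε / r k ≤ R`, so the induction hypothesis applies to
  -- every piece.
  set R := R₀ / r kmin with hR
  have hR0 : 0 < R := div_pos hR₀ (hr0 _)
  have base : ∀ ε > 0, ε ≤ R → R₀ ≤ ε → ∃ F : Finset E, (∀ x ∈ X, ∃ y ∈ F, dist x y ≤ ε) ∧
      (F.card : ℝ) ≤ (R / ε) ^ s := by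
    intro ε hε hεR hRε
    refine ⟨{x₀}, fun x hx => ⟨x₀, by simp, (hball x hx).trans hRε⟩, ?_⟩
    rw [Finset.card_singleton, Nat.cast_one]
    exact Real.one_le_rpow ((one_le_div hε).2 hεR) hs
  -- Induction on the number of rescalings: passing to a piece replaces `ε` by `ε / r k`, which
  -- gains at least one factor `1 / r kmax`.
  have step : ∀ m : ℕ, ∀ ε > 0, ε ≤ R → R₀ * r kmax ^ m ≤ ε →
      ∃ F : Finset E, (∀ x ∈ X, ∃ y ∈ F, dist x y ≤ ε) ∧ (F.card : ℝ) ≤ (R / ε) ^ s := by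
    intro m
    induction m with
    | zero =>
      intro ε hε hεR h
      exact base ε hε hεR (by simpa using h)
    | succ m ih =>
      intro ε hε hεR h
      rcases le_or_gt R₀ ε with hc | hc
      · exact base ε hε hεR hc
      have hk : ∀ k, ∃ F : Finset E, (∀ x ∈ X, ∃ y ∈ F, dist x y ≤ ε / r k) ∧
          (F.card : ℝ) ≤ (R / (ε / r k)) ^ s := by
        intro k
        refine ih (ε / r k) (div_pos hε (hr0 k)) ?_ ?_
        · exact div_le_div₀ hR₀.le hc.le (hr0 _) (hmin k)
        · rw [le_div_iff₀ (hr0 k)]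
          refine le_trans ?_ h
          rw [pow_succ, mul_assoc]
          have := hr0 kmax
          gcongr
          exact hmax k
      choose F hF hcard using hk
      refine ⟨Finset.univ.biUnion fun k => (F k).image (g k), fun x hx => ?_, ?_⟩
      · obtain ⟨k, z, hz, rfl⟩ := Set.mem_iUnion.1 (hcover hx)
        obtain ⟨y, hy, hyz⟩ := hF k z hz
        refine ⟨g k y, Finset.mem_biUnion.2 ⟨k, Finset.mem_univ k, Finset.mem_image_of_mem _ hy⟩, ?_⟩
        refine (hg k z y).trans ?_
        rw [mul_comm]
        exact (le_div_iff₀ (hr0 k)).1 hyz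
      · have h1 : ((Finset.univ.biUnion fun k => (F k).image (g k)).card : ℝ) ≤
            ∑ k, ((F k).card : ℝ) := by
          exact_mod_cast Finset.card_biUnion_le.trans
            (Finset.sum_le_sum fun k _ => Finset.card_image_le)
        refine h1.trans ((Finset.sum_le_sum fun k _ => hcard k).trans ?_)
        have h2 : ∀ k, (R / (ε / r k)) ^ s = (R / ε) ^ s * r k ^ s := by
          intro k
          rw [← Real.mul_rpow (by positivity) (hr0 k).le, div_div_eq_mul_div R ε, div_mul_eq_mul_div R ε]
        rw [Finset.sum_congr rfl fun k _ => h2 k, ← Finset.mul_sum]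
        exact mul_le_of_le_one_right (by positivity) hsum
  refine ⟨R, hR0, fun ε hε hεR => ?_⟩
  obtain ⟨m, hm⟩ := exists_pow_lt_of_lt_one (div_pos hε hR₀) (hr1 kmax)
  refine step m ε hε hεR ?_
  rw [mul_comm]
  exact ((lt_div_iff₀ hR₀).1 hm).le

theorem upperMinkowskiDim_le_of_cover {X : Set Plane} {R s : ℝ} (hR : 0 < R)
    (h : ∀ ε > 0, ε ≤ R → ∃ F : Finset Plane, (∀ x ∈ X, ∃ y ∈ F, dist x y ≤ ε) ∧
      (F.card : ℝ) ≤ (R / ε) ^ s) : upperMinkowskiDim X ≤ (s : EReal) := by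
  have hcoe : Filter.Tendsto (fun r : ℝ≥0 => (r : ℝ)) (nhdsWithin 0 (Set.Ioi 0))
      (nhdsWithin 0 (Set.Ioi 0)) := by
    refine tendsto_nhdsWithin_iff.2 ⟨?_, ?_⟩
    · exact (NNReal.continuous_coe.tendsto' 0 0 rfl).mono_left nhdsWithin_le_nhds
    · exact eventually_nhdsWithin_of_forall fun r hr => NNReal.coe_pos.2 hr
  have hlog : Filter.Tendsto (fun r : ℝ≥0 => Real.log (1 / (r : ℝ))) (nhdsWithin 0 (Set.Ioi 0))
      Filter.atTop := by
    simp only [one_div]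
    exact Real.tendsto_log_atTop.comp (tendsto_inv_nhdsGT_zero.comp hcoe)
  have hlim : Filter.Tendsto
      (fun r : ℝ≥0 => s * (Real.log R / Real.log (1 / (r : ℝ)) + 1))
      (nhdsWithin 0 (Set.Ioi 0)) (nhds s) := by
    have := ((hlog.const_div_atTop (Real.log R)).add_const 1).const_mul s
    simpa using this
  have hlim' : Filter.Tendsto
      (fun r : ℝ≥0 => ((s * (Real.log R / Real.log (1 / (r : ℝ)) + 1) : ℝ) : EReal))
      (nhdsWithin 0 (Set.Ioi 0)) (nhds (s : EReal)) :=
    (continuous_coe_real_ereal.tendsto s).comp hlim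
  have hle : ∀ᶠ r : ℝ≥0 in nhdsWithin 0 (Set.Ioi 0), (r : ℝ) ≤ R :=
    (hcoe.eventually (nhdsWithin_le_nhds (Iic_mem_nhds hR)))
  rw [← hlim'.limsup_eq]
  refine Filter.limsup_le_limsup ?_
  filter_upwards [hle, hlog.eventually_gt_atTop 0, self_mem_nhdsWithin] with r hrR hL hr
  have hr0 : (0 : ℝ) < r := NNReal.coe_pos.2 hr
  obtain ⟨F, hF, hcard⟩ := h r hr0 hrR
  have hcov : Metric.IsCover r X (F : Set Plane) := by
    intro x hx
    obtain ⟨y, hy, hxy⟩ := hF x hx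
    refine ⟨y, hy, ?_⟩
    change edist x y ≤ r
    rw [edist_nndist]
    exact_mod_cast hxy
  have h1 : (Metric.externalCoveringNumber r X : ℝ≥0∞) ≤ ENNReal.ofReal ((R / r) ^ s) := by
    have h2 := hcov.externalCoveringNumber_le_encard
    rw [Set.encard_coe_eq_coe_finsetCard] at h2
    calc (Metric.externalCoveringNumber r X : ℝ≥0∞) ≤ ((F.card : ℕ∞) : ℝ≥0∞) := by
          exact_mod_cast h2
      _ = ENNReal.ofReal (F.card : ℝ) := by simp
      _ ≤ _ := ENNReal.ofReal_le_ofReal hcard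
  have h3 : ENNReal.log (ENNReal.ofReal ((R / r) ^ s)) =
      ((s * (Real.log R + Real.log (1 / (r : ℝ))) : ℝ) : EReal) := by
    rw [ENNReal.log_ofReal_of_pos (by positivity), Real.log_rpow (by positivity),
      div_eq_mul_one_div R, Real.log_mul hR.ne' (by positivity)]
  calc ENNReal.log (Metric.externalCoveringNumber r X : ℝ≥0∞) /
        ((Real.log (1 / (r : ℝ)) : ℝ) : EReal)
      ≤ ENNReal.log (ENNReal.ofReal ((R / r) ^ s)) / ((Real.log (1 / (r : ℝ)) : ℝ) : EReal) :=
        EReal.div_le_div_right_of_nonneg (by exact_mod_cast hL.le) (ENNReal.log_monotone h1)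
    _ = _ := by
      rw [h3, ← EReal.coe_div]
      congr 1
      field_simp

theorem dist_affMap_le (M : Mat) (b x y : Plane) :
    dist (affMap M b x) (affMap M b y) ≤ ‖M‖ * dist x y := by
  rw [affMap, affMap, dist_add_right, dist_eq_norm, dist_eq_norm, ← map_sub]
  exact norm_lin_le M (x - y)

theorem IsSelfAffineSet.exists_subset_iUnion_word {K : Type*} {A : K → Mat} {v : K → Plane}
    {X : Set Plane} (h : IsSelfAffineSet A v X) (n : ℕ) :
    ∃ b : (Fin n → K) → Plane, X ⊆ ⋃ w, affMap (wordProd A w) (b w) '' X := by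
  induction n with
  | zero =>
    refine ⟨fun _ => 0, fun x hx => Set.mem_iUnion.2 ⟨Fin.elim0, x, hx, ?_⟩⟩
    rw [wordProd_zero, affMap, lin_one, add_zero]
  | succ n ih =>
    obtain ⟨b, hb⟩ := ih
    refine ⟨fun w => lin (A (w 0)) (b (Fin.tail w)) + v (w 0), fun x hx => ?_⟩
    rw [h.eq_iUnion] at hx
    obtain ⟨i, y, hy, rfl⟩ := Set.mem_iUnion.1 hx
    obtain ⟨w, z, hz, rfl⟩ := Set.mem_iUnion.1 (hb hy)
    refine Set.mem_iUnion.2 ⟨Fin.cons i w, z, hz, ?_⟩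
    simp [affMap, wordProd_cons, add_assoc]

theorem IsSelfAffineSet.upperMinkowskiDim_le {K : Type*} [Fintype K] {A : K → Mat} {v : K → Plane}
    {X : Set Plane} (h : IsSelfAffineSet A v X) {n : ℕ}
    (hpos : ∀ w : Fin n → K, 0 < ‖wordProd A w‖) (hlt : ∀ w : Fin n → K, ‖wordProd A w‖ < 1)
    {s : ℝ} (hs : 0 ≤ s) (hsum : wordNormSum A s 1 n ≤ 1) :
    upperMinkowskiDim X ≤ (s : EReal) := by
  obtain ⟨b, hb⟩ := h.exists_subset_iUnion_word n
  obtain ⟨R, hR, hcov⟩ := exists_cover_card_le hpos hlt (fun w => dist_affMap_le _ (b w))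
    h.nonempty h.isCompact.isBounded hb hs (by simpa [wordNormSum] using hsum)
  exact upperMinkowskiDim_le_of_cover hR hcov

end Minkowski

/-! ### Pressure in terms of the norm sums -/

section Pressure

variable {J : Type*} [Fintype J]

theorem le_pressure {Γ : Set (ℕ → J)} {A : J → Mat} {s : ℝ≥0} {c : ℝ}
    (h : ∀ n : ℕ, 1 ≤ n → ENNReal.ofReal (Real.exp (n * c)) ≤ wordSum Γ A s n) :
    (c : EReal) ≤ pressure Γ A s := by
  refine le_iInf₂ fun n hn => ?_
  have hn0 : (0 : ℝ) < n := by exact_mod_cast hn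
  have h1 := ENNReal.log_monotone (h n hn)
  rw [ENNReal.log_ofReal_of_pos (Real.exp_pos _), Real.log_exp] at h1
  refine le_trans (le_of_eq ?_) (EReal.div_le_div_right_of_nonneg (by exact_mod_cast hn0.le) h1)
  rw [← EReal.coe_div, mul_div_cancel_left₀ c hn0.ne']

theorem pressure_nonpos {Γ : Set (ℕ → J)} {A : J → Mat} {s : ℝ≥0} {n : ℕ} (hn : 1 ≤ n)
    (h : wordSum Γ A s n ≤ 1) : pressure Γ A s ≤ 0 := by
  refine (iInf₂_le n hn).trans ?_
  have hn0 : (0 : EReal) ≤ ((n : ℝ) : EReal) := by exact_mod_cast n.cast_nonneg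
  refine (EReal.div_le_div_right_of_nonneg hn0 (ENNReal.log_le_zero_iff.2 h)).trans_eq ?_
  exact EReal.zero_div

theorem wordSum_univ {A : J → Mat} {s : ℝ≥0} (hs : s ≤ 1) {n : ℕ} (hn : 1 ≤ n) :
    wordSum Set.univ A s n = ENNReal.ofReal (wordNormSum A s 1 n) := by
  have h : ∀ w : Fin n → J, w ∈ prefixes Set.univ n := fun w =>
    -- The finite word is continued by repeating its first letter, which exists since `1 ≤ n`.
    ⟨fun k => if h : k < n then w ⟨k, h⟩ else w ⟨0, hn⟩, trivial, fun k => by simp⟩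
  rw [wordSum, wordNormSum, ENNReal.ofReal_sum_of_nonneg
    fun w _ => Real.rpow_nonneg (norm_nonneg _) _]
  simp [h, singularValueFunction_of_le_one hs]

omit [Fintype J] in
theorem mem_prefixes_invertibleWords {A : J → Mat} {n : ℕ} (hn : 1 ≤ n) (w : Fin n → J) :
    w ∈ prefixes (invertibleWords A) n ↔ ∀ k, IsUnit (A (w k)) := by
  constructor
  · rintro ⟨j, hj, hw⟩ k
    rw [hw]
    exact hj k
  · intro h
    refine ⟨fun k => if h : k < n then w ⟨k, h⟩ else w ⟨0, hn⟩, fun k => ?_, fun k => by simp⟩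
    dsimp only
    split_ifs
    · exact h _
    · exact h _

open Classical in
theorem wordSum_invertibleWords {A : J → Mat} {s : ℝ≥0} (hs : s ≤ 1) {n : ℕ} (hn : 1 ≤ n) :
    wordSum (invertibleWords A) A s n =
      ENNReal.ofReal (wordNormSum (fun i : {i : J // IsUnit (A i)} => A i) s 1 n) := by
  rw [wordSum, wordNormSum, ENNReal.ofReal_sum_of_nonneg
    fun w _ => Real.rpow_nonneg (norm_nonneg _) _]
  symm
  refine Finset.sum_bij (fun w _ k => (w k : J)) (fun w _ => ?_) (fun w _ w' _ h => ?_)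
    (fun w hw => ?_) (fun w _ => ?_)
  · exact Finset.mem_filter.2 ⟨Finset.mem_univ _,
      (mem_prefixes_invertibleWords hn _).2 fun k => (w k).2⟩
  · ext k
    exact congrFun h k
  · have := (mem_prefixes_invertibleWords hn w).1 (Finset.mem_filter.1 hw).2
    exact ⟨fun k => ⟨w k, this k⟩, Finset.mem_univ _, rfl⟩
  · rw [singularValueFunction_of_le_one hs, one_mul]
    rfl

end Pressure

/-! ### Dependence of the norm sums on the exponent -/

section NormSums

variable {K : Type*} [Fintype K] {A : K → Mat}

omit [Fintype K] in
theorem norm_wordProd_le_pow {ρ : ℝ} (hρ : ∀ i, ‖A i‖ ≤ ρ) {n : ℕ} (w : Fin n → K) :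
    ‖wordProd A w‖ ≤ ρ ^ n := by
  induction n with
  | zero => simp [wordProd_zero]
  | succ n ih =>
    rw [← Fin.cons_self_tail w, wordProd_cons, pow_succ']
    exact (norm_mul_le _ _).trans (mul_le_mul (hρ _) (ih _) (norm_nonneg _)
      ((norm_nonneg _).trans (hρ (w 0))))

omit [Fintype K] in
theorem norm_wordProd_pos (h : ∀ i, IsUnit (A i)) {n : ℕ} (w : Fin n → K) :
    0 < ‖wordProd A w‖ := by
  have : IsUnit (wordProd A w) := by
    induction n with
    | zero => simp [wordProd_zero]
    | succ n ih =>
      rw [← Fin.cons_self_tail w, wordProd_cons]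
      exact (h _).mul (ih _)
  exact norm_pos_iff.2 this.ne_zero

theorem continuous_wordNormSum (h : ∀ i, IsUnit (A i)) (n : ℕ) :
    Continuous fun s : ℝ => wordNormSum A s 1 n := by
  simp only [wordNormSum, one_mul]
  exact continuous_finsetSum _ fun w _ =>
    continuous_const.rpow continuous_id fun _ => Or.inl (norm_wordProd_pos h w).ne'

theorem wordNormSum_anti (hA : ∀ i, ‖A i‖ ≤ 1) {s t : ℝ} (hs : 0 ≤ s) (hst : s < t) (n : ℕ) :
    wordNormSum A t 1 n ≤ wordNormSum A s 1 n := by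
  simp only [wordNormSum, one_mul]
  refine Finset.sum_le_sum fun w _ => ?_
  have h1 : ‖wordProd A w‖ ≤ 1 := by simpa using norm_wordProd_le_pow hA w
  -- Products may vanish; as `0 < t`, such a word contributes zero on the left even if `s = 0`,
  -- where `0 ^ 0 = 1`.
  rcases eq_or_lt_of_le (norm_nonneg (wordProd A w)) with h0 | h0
  · rw [← h0, Real.zero_rpow (hs.trans_lt hst).ne']
    exact Real.rpow_nonneg le_rfl _
  · exact Real.rpow_le_rpow_of_exponent_ge h0 h1 hst.le

theorem wordNormSum_le_pow_mul (h : ∀ i, IsUnit (A i)) {ρ : ℝ} (hρ0 : 0 < ρ)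
    (hρ : ∀ i, ‖A i‖ ≤ ρ) {s t : ℝ} (hst : s ≤ t) (n : ℕ) :
    wordNormSum A t 1 n ≤ Real.exp (n * ((t - s) * Real.log ρ)) * wordNormSum A s 1 n := by
  simp only [wordNormSum, one_mul, Finset.mul_sum]
  refine Finset.sum_le_sum fun w _ => ?_
  have h0 := norm_wordProd_pos h w
  have h1 : Real.exp (n * ((t - s) * Real.log ρ)) = (ρ ^ n) ^ (t - s) := by
    rw [Real.rpow_def_of_pos (by positivity), Real.log_pow]
    ring_nf
  rw [h1, ← sub_add_cancel t s, Real.rpow_add h0, add_sub_cancel_right]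
  exact mul_le_mul_of_nonneg_right (Real.rpow_le_rpow h0.le (norm_wordProd_le_pow hρ w)
    (sub_nonneg.2 hst)) (Real.rpow_nonneg h0.le _)

end NormSums

/-! ### Comparison of the affinity dimensions -/

section AffinityDim

variable {J : Type*} [Fintype J] {A : J → Mat}

theorem exists_pressure_nonpos_of_affinityDim_lt {Γ : Set (ℕ → J)} {s : ℝ≥0}
    (h : affinityDim Γ A < s) : ∃ t < s, pressure Γ A t ≤ 0 := by
  obtain ⟨t, ht⟩ := iInf_lt_iff.1 h
  obtain ⟨ht', hlt⟩ := iInf_lt_iff.1 ht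
  exact ⟨t, by exact_mod_cast hlt, ht'⟩

theorem affinityDim_le {Γ : Set (ℕ → J)} {s : ℝ≥0} (h : pressure Γ A s ≤ 0) :
    affinityDim Γ A ≤ s := iInf₂_le s h

theorem exists_norm_bound (hA : ∀ i, ‖A i‖ < 1) :
    ∃ ρ : ℝ, 0 < ρ ∧ ρ < 1 ∧ ∀ i, ‖A i‖ ≤ ρ := by
  rcases isEmpty_or_nonempty J with _ | _
  · exact ⟨1 / 2, by norm_num, by norm_num, isEmptyElim⟩
  · obtain ⟨i, hi⟩ := Finite.exists_max fun i => ‖A i‖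
    exact ⟨max ‖A i‖ (1 / 2), lt_max_of_lt_right (by norm_num), max_lt (hA i) (by norm_num),
      fun j => (hi j).trans (le_max_left _ _)⟩

open Classical in
-- There is `t < s` with non-positive pressure. If all sums at `s` exceeded 1, uniform contraction
-- would make those at `t` at least `ρ ^ (-n (s - t))`, and the pressure at `t` would be positive.
theorem exists_wordNormSum_lt_one (hA : ∀ i, ‖A i‖ < 1) {s : ℝ≥0} (hs : s ≤ 1)
    (h : affinityDim (invertibleWords A) A < s) :
    ∃ n, 1 ≤ n ∧ wordNormSum (fun i : {i : J // IsUnit (A i)} => A i) s 1 n ≤ 1 := by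
  obtain ⟨t, hts, ht⟩ := exists_pressure_nonpos_of_affinityDim_lt h
  obtain ⟨ρ, hρ0, hρ1, hρ⟩ := exists_norm_bound hA
  have hlog : Real.log ρ < 0 := Real.log_neg hρ0 hρ1
  have hts' : (0 : ℝ) < s - t := sub_pos.2 (by exact_mod_cast hts)
  by_contra! hcon
  refine absurd (le_trans (le_pressure (c := -((s - t) * Real.log ρ)) fun n hn => ?_) ht) ?_
  · rw [wordSum_invertibleWords (hts.le.trans hs) hn]
    refine ENNReal.ofReal_le_ofReal ?_
    have h1 := (hcon n hn).le.trans (wordNormSum_le_pow_mul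
      (A := fun i : {i : J // IsUnit (A i)} => A i) (fun i => i.2) hρ0 (fun i => hρ i)
      (s := t) (t := s) (by exact_mod_cast hts.le) n)
    rw [mul_neg, Real.exp_neg, inv_le_iff_one_le_mul₀ (Real.exp_pos _), mul_comm]
    exact h1
  · rw [not_le]
    have : 0 < -((s - t) * Real.log ρ) := by nlinarith
    exact_mod_cast this

open Classical in
-- A sum below 1 at `s > 0` would stay below 1 at some smaller exponent by continuity; as the
-- pressure is an infimum over lengths, this contradicts the minimality of `s`. At `s = 0` the sum
-- counts words.
theorem one_le_wordNormSum_affinityDim [Nonempty {i : J // IsUnit (A i)}] {s : ℝ≥0} (hs : s ≤ 1)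
    (h : affinityDim (invertibleWords A) A = s) (n : ℕ) :
    1 ≤ wordNormSum (fun i : {i : J // IsUnit (A i)} => A i) s 1 n := by
  rcases Nat.eq_zero_or_pos n with rfl | hn
  · simp [wordNormSum_zero]
  by_contra! hcon
  rcases eq_or_ne s 0 with rfl | hs0
  · refine absurd hcon (not_lt.2 ?_)
    simp only [wordNormSum, NNReal.coe_zero, Real.rpow_zero, Finset.sum_const, nsmul_eq_mul,
      mul_one]
    exact_mod_cast Finset.card_pos.2 Finset.univ_nonempty
  have hs0' : (0 : ℝ) < s := NNReal.coe_pos.2 (pos_iff_ne_zero.2 hs0)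
  have hev := ((continuous_wordNormSum (A := fun i : {i : J // IsUnit (A i)} => A i)
    (fun i => i.2) n).continuousAt (x := (s : ℝ))).eventually_lt_const hcon
  obtain ⟨t, ht, ht0, hts⟩ := ((hev.filter_mono nhdsWithin_le_nhds).and
    (Ioo_mem_nhdsLT hs0')).exists
  lift t to ℝ≥0 using ht0.le
  have hts' : t < s := by exact_mod_cast hts
  have h1 : affinityDim (invertibleWords A) A ≤ t := affinityDim_le (pressure_nonpos hn (by
    rw [wordSum_invertibleWords (hts'.le.trans hs) hn]
    exact ENNReal.ofReal_le_one.2 ht.le))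
  rw [h] at h1
  exact absurd (by exact_mod_cast h1) (not_le.2 hts')

theorem IsQuasiMultiplicative.le_affinityDim {δ : ℝ} (h : IsQuasiMultiplicative A δ) (hδ : 0 < δ)
    (hδ1 : δ ≤ 1) (hA : ∀ i, ‖A i‖ ≤ 1) {s : ℝ≥0} (hs : 0 < s) (hs1 : s ≤ 1) {n : ℕ}
    (hn : 1 < δ / (1 + Fintype.card J) * wordNormSum A s 1 (n + 1)) :
    (s : ℝ≥0∞) ≤ affinityDim Set.univ A := by
  refine le_iInf₂ fun t ht => ?_
  by_contra! hts
  have hts' : t < s := by exact_mod_cast hts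
  set θ := δ / (1 + Fintype.card J) * wordNormSum A s 1 (n + 1) with hθ
  have hθ0 : 0 < θ := one_pos.trans hn
  have hpos : 0 < Real.log θ / (n + 1) := div_pos (Real.log_pos hn) (by positivity)
  refine absurd ((le_pressure (c := Real.log θ / (n + 1)) fun k hk => ?_).trans ht)
    (not_le.2 (by exact_mod_cast hpos))
  rw [wordSum_univ (hts'.le.trans hs1) hk]
  refine ENNReal.ofReal_le_ofReal (le_trans ?_
    (wordNormSum_anti hA t.2 (NNReal.coe_lt_coe.2 hts') k))
  -- The sum for length `(n + 1) k` is at least `θ ^ k` by quasi-multiplicativity and at most the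
  -- `(n + 1)`-st power of the sum for length `k`; comparing the two bounds every length `k` without
  -- losing a constant.
  refine le_of_pow_le_pow_left₀ n.succ_ne_zero (wordNormSum_nonneg _ _ _ _) ?_
  have h1 : Real.exp (k * (Real.log θ / (n + 1))) ^ (n + 1) = θ ^ k := by
    rw [← Real.exp_nat_mul, ← Real.exp_log (pow_pos hθ0 k), Real.log_pow]
    congr 1
    push_cast
    field_simp
  rw [h1]
  refine (h.pow_le_wordNormSum_mul hδ hδ1 hA (NNReal.coe_pos.2 hs) (by exact_mod_cast hs1)
    (n + 1) k).trans ?_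
  rw [mul_comm]
  exact wordNormSum_mul_le A s.2 k (n + 1)

/-- For a quasi-multiplicative tuple which contains a non-zero singular matrix, the affinity
dimension of the invertible matrices is strictly smaller than that of the whole tuple. -/
theorem IsQuasiMultiplicative.exists_le_affinityDim {δ : ℝ} (h : IsQuasiMultiplicative A δ)
    (hδ : 0 < δ) (hδ1 : δ ≤ 1) (hA : ∀ i, ‖A i‖ ≤ 1) [Nonempty {i : J // IsUnit (A i)}]
    {i₀ : J} (hi₀ : ¬ IsUnit (A i₀)) (hne : A i₀ ≠ 0)
    (haff : affinityDim (invertibleWords A) A < 1) :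
    ∃ s : ℝ≥0, s ≤ 1 ∧ affinityDim (invertibleWords A) A < s ∧
      (s : ℝ≥0∞) ≤ affinityDim Set.univ A := by
  classical
  lift affinityDim (invertibleWords A) A to ℝ≥0 using (haff.trans ENNReal.one_lt_top).ne with s₀ hs₀
  have hs₀1 : s₀ < 1 := by exact_mod_cast haff
  have hY := one_le_wordNormSum_affinityDim hs₀1.le hs₀.symm
  set c := δ / (1 + (Fintype.card J : ℝ)) with hc
  have hc0 : 0 < c := by positivity
  have hB : 0 < ‖A i₀‖ := norm_pos_iff.2 hne
  have hq : 0 < c * (c * (δ * ‖A i₀‖) / 12) := by positivity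
  -- The length is fixed before the exponent: the growth constants do not depend on `t`, so `t` need
  -- only be close to `s₀` for finitely many `m`.
  obtain ⟨n, hn⟩ := exists_nat_gt (1 / (c * (c * (δ * ‖A i₀‖) / 12)))
  have hev : ∀ᶠ t : ℝ in nhds (s₀ : ℝ), ∀ m ∈ Finset.range (n + 2),
      1 / 2 < wordNormSum (fun i : {i : J // IsUnit (A i)} => A i) t 1 m := by
    rw [Filter.eventually_all_finset]
    intro m _
    exact (continuous_wordNormSum (A := fun i : {i : J // IsUnit (A i)} => A i)
      (fun i => i.2) m).continuousAt.eventually_const_lt (by linarith [hY m])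
  have hs₀1' : (s₀ : ℝ) < 1 := by exact_mod_cast hs₀1
  obtain ⟨t, ht, hst, ht1⟩ := ((hev.filter_mono nhdsWithin_le_nhds).and
    (Ioo_mem_nhdsGT hs₀1')).exists
  have ht0 : 0 < t := s₀.2.trans_lt hst
  lift t to ℝ≥0 using ht0.le
  refine ⟨t, by exact_mod_cast ht1.le, ?_, ?_⟩
  · exact_mod_cast hst
  refine h.le_affinityDim hδ hδ1 hA (by exact_mod_cast ht0) (by exact_mod_cast ht1.le) (n := n) ?_
  have h1 := h.linear_growth (P := fun i => IsUnit (A i)) hδ hδ1 hA ht0 ht1.le hi₀ (n := n)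
    fun m hm => (ht m (Finset.mem_range.2 (by omega))).le
  rw [div_lt_iff₀ hq] at hn
  have h2 := mul_le_mul_of_nonneg_left h1 hc0.le
  linarith

end AffinityDim

theorem IsSelfAffineSet.upperMinkowskiDim_le_of_contractive {K : Type*} [Fintype K] {A : K → Mat}
    {v : K → Plane} {X : Set Plane} (h : IsSelfAffineSet A v X) (hu : ∀ i, IsUnit (A i))
    (hA : ∀ i, ‖A i‖ < 1) {n : ℕ} (hn : 1 ≤ n) {s : ℝ} (hs : 0 ≤ s)
    (hsum : wordNormSum A s 1 n ≤ 1) : upperMinkowskiDim X ≤ (s : EReal) := by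
  obtain ⟨ρ, hρ0, hρ1, hρ⟩ := exists_norm_bound hA
  exact h.upperMinkowskiDim_le (norm_wordProd_pos hu)
    (fun w => (norm_wordProd_le_pow hρ w).trans_lt (pow_lt_one₀ hρ0.le hρ1 (by omega))) hs hsum

end PlanarAffine

end

/-! ### The dimension gap -/

theorem mainTheorem4 {J : Type*} [Fintype J]
    (A : J → PlanarAffine.Mat) (v : J → PlanarAffine.Plane)
    (hIFS : PlanarAffine.IsAffineIFS A v)
    (X' X : Set PlanarAffine.Plane)
    (hX' : PlanarAffine.IsSelfAffineSet A v X')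
    (hX : PlanarAffine.IsSelfAffineSet
      (fun i : {i : J // IsUnit (A i)} => A i) (fun i : {i : J // IsUnit (A i)} => v i) X)
    (hA : PlanarAffine.IsDominated A ∨ PlanarAffine.IsIrreducible A)
    (hrank : ∃ i, (A i).rank = 1)
    (haff : PlanarAffine.affinityDim (PlanarAffine.invertibleWords A) A < 1)
    (hdim : dimH X' = min 2 (PlanarAffine.affinityDim Set.univ A)) :
    PlanarAffine.upperMinkowskiDim X < ((dimH X' : ℝ≥0∞) : EReal) := by
  classical
  open PlanarAffine Matrix.Norms.L2Operator in
  have hlt : ∀ i, ‖A i‖ < 1 := hIFS.contractive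
  obtain ⟨i₀, hi₀⟩ := hrank
  have : Nonempty J := ⟨i₀⟩
  have hne : A i₀ ≠ 0 := by
    intro h0
    rw [h0, Matrix.rank_zero] at hi₀
    exact zero_ne_one hi₀
  have hsing : ¬ IsUnit (A i₀) := by
    intro hu
    have := Matrix.rank_of_isUnit _ hu
    rw [hi₀, Fintype.card_fin] at this
    omega
  have hI : Nonempty {i : J // IsUnit (A i)} := by
    obtain ⟨x, hx⟩ := hX.nonempty
    rw [hX.eq_iUnion] at hx
    exact ⟨(Set.mem_iUnion.1 hx).choose⟩
  obtain ⟨δ, hδ, hδ1, hQ⟩ : ∃ δ : ℝ, 0 < δ ∧ δ ≤ 1 ∧ PlanarAffine.IsQuasiMultiplicative A δ :=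
    hA.elim (fun h => h.exists_isQuasiMultiplicative) fun h => h.exists_isQuasiMultiplicative
  obtain ⟨s₁, hs₁1, hs₁, hs₁J⟩ := hQ.exists_le_affinityDim hδ hδ1 (fun i => (hlt i).le) hsing hne
    haff
  obtain ⟨s, hs, hss₁⟩ := ENNReal.lt_iff_exists_nnreal_btwn.1 hs₁
  have hss₁' : s < s₁ := by exact_mod_cast hss₁
  obtain ⟨n, hn, hsum⟩ := PlanarAffine.exists_wordNormSum_lt_one hlt (hss₁'.le.trans hs₁1) hs
  have hu : ∀ i : {i : J // IsUnit (A i)}, IsUnit (A i) := fun i => i.2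
  have hM := hX.upperMinkowskiDim_le_of_contractive hu (fun i => hlt i) hn s.2 hsum
  -- Since `s₁ ≤ 1`, the cap at 2 plays no role.
  have hdimle : (s₁ : ℝ≥0∞) ≤ dimH X' := by
    rw [hdim]
    refine le_min ?_ hs₁J
    exact_mod_cast hs₁1.trans one_le_two
  refine hM.trans_lt (lt_of_lt_of_le ?_ (EReal.coe_ennreal_le_coe_ennreal_iff.2 hdimle))
  change ((s : ℝ) : EReal) < ((s₁ : ℝ) : EReal)
  exact_mod_cast hss₁'
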